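/- Let $N\ge 2$ and let $(x_i,y_i)\in\mathbb R^2$, $0\le i\le N$, with $x_0<x_1<\dots<x_N$ equally spaced, i.e. $x_i-x_{i-1}=(x_N-x_0)/N$ for $1\le i\le N$; write $I=[x_0,x_N]$. Let $b$ be the linear (i.e. degree-at-most-one polynomial) function with $b(x_0)=y_0$, $b(x_N)=y_N$; let $h$ be the function on $I$ with $h(x_i)=y_i$ for $0\le i\le N$ that is linear on each $[x_{i-1},x_i]$; and let $L_i$ be the linear function on $I$ with $L_i(x_0)=x_{i-1}$, $L_i(x_N)=x_i$. Let $S:I\to\mathbb R$ be Lipschitz with $0<S(x)<1$ for all $x\in I$, and let $f$ be the generalized affine fractal interpolation function with vertical scaling function $S$, i.e. the continuous function $f:I\to\mathbb R$ whose graph $\Gamma f=\{(x,f(x)):x\in I\}$ satisfies $\Gamma f=\bigcup_{i=1}^N W_i(\Gamma f)$, where $W_i(x,y)=\bigl(L_i(x),\,S(L_i(x))(y-b(x))+h(L_i(x))\bigr)$. For a closed interval $E=[a,c]$, $k\ge 0$ and $1\le j\le N^k$ put $E^k_j=\bigl[a+\tfrac{j-1}{N^k}(c-a),\,a+\tfrac{j}{N^k}(c-a)\bigr]$,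 and let $O_k(f,I)=\sum_{j=1}^{N^k}\sup_{x',x''\in I^k_j}|f(x')-f(x'')|$. For $k\ge1$, $1\le i\le N$, $1\le j\le N^k$ let $\overline s^k_{i,j}$ and $\underline s^k_{i,j}$ be the maximum and the minimum of $|S|$ on $(I_i)^k_j$, where $I_i=[x_{i-1},x_i]$. Let $M_k$ be the $N^k\times N^k$ matrix such that for $1\le i\le N$, $1\le \ell\le N^{k-1}$, $1\le j\le N^k$ $$(M_k)_{(i-1)N^{k-1}+\ell,\;j}=\begin{cases}\overline s^k_{i,j}, & (\ell-1)N<j\le \ell N,\\ 0,&\text{otherwise,}\end{cases}$$ and let $M_k'$ be defined in the same way with $\underline s^k_{i,j}$ in place of $\overline s^k_{i,j}$. Let $\rho(\cdot)$ denote the spectral radius. For a bounded set $E\subset\mathbb R^2$ let $\mathcal N_E(\varepsilon)$ be the number of squares $[k_1\varepsilon,(k_1+1)\varepsilon]\times[k_2\varepsilon,(k_2+1)\varepsilon]$, $k_1,k_2\in\mathbb Z$, that meet $E$; the statement $\dim_B E=d$ means that the lower and the upper limit of $\log\mathcal N_E(\varepsilon)/\log(1/\varepsilon)$ as $\varepsilon\to0+$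 both equal $d$. Then the limits $\lim_{k\to\infty}\rho(M_k)$ and $\lim_{k\to\infty}\rho(M'_k)$ exist and coincide; denote the common value by $\rho_S$. If $\lim_{p\to\infty}O_p(f,I)=\infty$ and $\rho_S>1$, then $$\dim_B\Gamma f=1+\frac{\log\rho_S}{\log N}.$$ Otherwise, $\dim_B\Gamma f=1$. -/

import Mathlib

open Filter Topology

noncomputable section

namespace FIF

/-! ### Box dimension of subsets of the plane -/

/-- The `ε`-coordinate square `[k₁ε, (k₁+1)ε] × [k₂ε, (k₂+1)ε]`. -/
def coordSquare (ε : ℝ) (k : ℤ × ℤ) : Set (ℝ × ℝ) :=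
  Set.Icc (k.1 * ε) ((k.1 + 1) * ε) ×ˢ Set.Icc (k.2 * ε) ((k.2 + 1) * ε)

/-- The number of `ε`-coordinate squares meeting `E` (a finite number if `E` is bounded and
`ε > 0`). -/
def boxCount (E : Set (ℝ × ℝ)) (ε : ℝ) : ℕ :=
  Set.ncard {k : ℤ × ℤ | (coordSquare ε k ∩ E).Nonempty}

/-- Upper box dimension of a bounded set. -/
def upperBoxDim (E : Set (ℝ × ℝ)) : EReal :=
  limsup (fun ε : ℝ => ((Real.log (boxCount E ε) / Real.log (1 / ε) : ℝ) : EReal)) (𝓝[>] 0)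

/-- Lower box dimension of a bounded set. -/
def lowerBoxDim (E : Set (ℝ × ℝ)) : EReal :=
  liminf (fun ε : ℝ => ((Real.log (boxCount E ε) / Real.log (1 / ε) : ℝ) : EReal)) (𝓝[>] 0)

/-- The box dimension of `E` exists and equals `d`. -/
def HasBoxDim (E : Set (ℝ × ℝ)) (d : ℝ) : Prop :=
  lowerBoxDim E = (d : EReal) ∧ upperBoxDim E = (d : EReal)

/-! ### Generalized affine fractal interpolation functions -/

/-- `g` agrees on `E` with a function `t ↦ m t + c`. -/
def IsLinearOn (g : ℝ → ℝ) (E : Set ℝ) : Prop :=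
  ∃ m c : ℝ, ∀ t ∈ E, g t = m * t + c

/-- The interval `[x₀, x_N]` spanned by the nodes. -/
def nodeInterval {N : ℕ} (x : Fin (N + 1) → ℝ) : Set ℝ :=
  Set.Icc (x 0) (x (Fin.last N))

/-- The map `W(x, y) = (ℓ(x), S(ℓ(x)) (y - b(x)) + h(ℓ(x)))`. -/
def ifsMap (b h S ℓ : ℝ → ℝ) (p : ℝ × ℝ) : ℝ × ℝ :=
  (ℓ p.1, S (ℓ p.1) * (p.2 - b p.1) + h (ℓ p.1))

/-- `f` is the generalized affine fractal interpolation function on `[x₀, x_N]` with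
interpolation data `(x_i, y_i)`, `0 ≤ i ≤ N`, and vertical scaling function `S`, where `b` is the
linear function through the two extreme data points, `h` the piecewise linear interpolant of the
data, and `L i` (for `i : Fin N`, counted from `0`) the linear function taking `[x₀, x_N]` onto
`[x_i, x_{i+1}]`: `f` is continuous and its graph is invariant under the resulting iterated
function system. -/
structure IsGeneralizedAffineFIF {N : ℕ} (x y : Fin (N + 1) → ℝ) (b h : ℝ → ℝ)
    (L : Fin N → ℝ → ℝ) (S f : ℝ → ℝ) : Prop where
  b_linear : IsLinearOn b (nodeInterval x)
  b_left : b (x 0) = y 0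
  b_right : b (x (Fin.last N)) = y (Fin.last N)
  h_node : ∀ i : Fin (N + 1), h (x i) = y i
  h_linear : ∀ i : Fin N, IsLinearOn h (Set.Icc (x i.castSucc) (x i.succ))
  L_linear : ∀ i : Fin N, IsLinearOn (L i) (nodeInterval x)
  L_left : ∀ i : Fin N, L i (x 0) = x i.castSucc
  L_right : ∀ i : Fin N, L i (x (Fin.last N)) = x i.succ
  S_continuous : ContinuousOn S (nodeInterval x)
  S_abs_lt_one : ∀ t ∈ nodeInterval x, |S t| < 1
  f_continuous : ContinuousOn f (nodeInterval x)
  graph_invariant : (nodeInterval x).graphOn f =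
    ⋃ i : Fin N, ifsMap b h S (L i) '' (nodeInterval x).graphOn f

/-! ### Oscillations -/

/-- For `E = [a, b]`, the `j`-th (counted from `0`) of the `N ^ k` closed subintervals of equal
length into which `E` is divided. -/
def subInterval (N : ℕ) (a b : ℝ) (k j : ℕ) : Set ℝ :=
  Set.Icc (a + (j : ℝ) / (N : ℝ) ^ k * (b - a)) (a + ((j : ℝ) + 1) / (N : ℝ) ^ k * (b - a))

/-- Oscillation of `g` on `U`: the supremum of `|g s - g t|` over `s, t ∈ U`. -/
def oscillation (g : ℝ → ℝ) (U : Set ℝ) : ℝ :=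
  Metric.diam (g '' U)

/-- The total oscillation `O_k(g, [a, b])`. -/
def totalOsc (N k : ℕ) (g : ℝ → ℝ) (a b : ℝ) : ℝ :=
  ∑ j ∈ Finset.range (N ^ k), oscillation g (subInterval N a b k j)

/-! ### Vertical scaling matrices -/

/-- `I_{i,j}^k` for `I = [a, b]`: divide `I` into `N` equal parts, take the `i`-th one, divide it
into `N ^ k` equal parts and take the `j`-th one (both indices counted from `0`). -/
def subSubInterval (N : ℕ) (a b : ℝ) (k i j : ℕ) : Set ℝ :=
  subInterval N (a + (i : ℝ) / N * (b - a)) (a + ((i : ℝ) + 1) / N * (b - a)) k j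

/-- The maximum of `|S|` over `I_{i,j}^k`. -/
def sUpper (N : ℕ) (a b : ℝ) (S : ℝ → ℝ) (k i j : ℕ) : ℝ :=
  sSup ((fun t => |S t|) '' subSubInterval N a b k i j)

/-- The minimum of `|S|` over `I_{i,j}^k`. -/
def sLower (N : ℕ) (a b : ℝ) (S : ℝ → ℝ) (k i j : ℕ) : ℝ :=
  sInf ((fun t => |S t|) '' subSubInterval N a b k i j)

/-- The `N ^ k × N ^ k` matrix (`k ≥ 1`) whose entry in row `i * N ^ (k - 1) + l`
(`0 ≤ i < N`, `0 ≤ l < N ^ (k - 1)`) and column `j` is `s i j` if `l * N ≤ j < (l + 1) * N`, and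
`0` otherwise. -/
def scalingPattern (N k : ℕ) (s : ℕ → ℕ → ℝ) : Matrix (Fin (N ^ k)) (Fin (N ^ k)) ℝ :=
  Matrix.of fun r j =>
    if ((r : ℕ) % N ^ (k - 1)) * N ≤ (j : ℕ) ∧ (j : ℕ) < ((r : ℕ) % N ^ (k - 1) + 1) * N then
      s ((r : ℕ) / N ^ (k - 1)) (j : ℕ)
    else 0

/-- The vertical scaling matrix `M_k` of level `k ≥ 1` (built from maxima of `|S|`). -/
def upperMatrix (N : ℕ) (a b : ℝ) (S : ℝ → ℝ) (k : ℕ) : Matrix (Fin (N ^ k)) (Fin (N ^ k)) ℝ :=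
  scalingPattern N k (sUpper N a b S k)

/-- The vertical scaling matrix `M'_k` of level `k ≥ 1` (built from minima of `|S|`). -/
def lowerMatrix (N : ℕ) (a b : ℝ) (S : ℝ → ℝ) (k : ℕ) : Matrix (Fin (N ^ k)) (Fin (N ^ k)) ℝ :=
  scalingPattern N k (sLower N a b S k)

/-- Spectral radius of a real square matrix: the largest modulus of a complex eigenvalue. -/
def matrixSpectralRadius {n : ℕ} (X : Matrix (Fin n) (Fin n) ℝ) : ℝ :=
  (spectralRadius ℂ (X.map (fun r : ℝ => (r : ℂ)))).toReal

end FIF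

end

/-!
For positive `S` with Lipschitz logarithm consider the transfer operator
`T φ t = ∑ i, S (b_i t) φ (b_i t)`, where `b_i` maps `[x₀, x_N]` affinely onto its `i`-th `N`-th
part. As the `b_i` contract distances by a factor `N ≥ 2`, `T` preserves the cone of functions with
`Λ`-Lipschitz logarithm for large `Λ`. In this cone there is a threshold `ρ > 0`: every positive
`r < ρ` has an element with `r φ ≤ T φ` and every `r > ρ` one with `T φ ≤ r φ`. Indeed
`φ = ∑ k < n, r⁻ᵏ Tᵏ 1` serves as soon as `T ^ n 1 ≥ r ^ n`, respectively `T ^ n 1 ≤ r ^ n`, on the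
whole interval, and `T ^ n 1` has distortion bounded independently of `n`. Three consequences
follow.

* Row vectors of samples of such `φ` at the left end points of the `N ^ k` subintervals are almost
  sub- and supereigenvectors of `M_k` and `M'_k`, so both spectral radii tend to `ρ` by
  Collatz–Wielandt bounds.
* Let `V_p` be the sum of the oscillations of `f` over the subintervals of level `p`, weighted by
  the samples of `φ`. By self-affinity `V_{p+1}` is the same sum of level `p` with weight `T φ`, up
  to a bounded error, hence `V_{p+1} ≤ r V_p + O(1)` or `V_{p+1} ≥ r V_p - O(1)`. So the total
  oscillation grows like `ρ ^ p`, provided that it is unbounded and `ρ > 1`.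
* A graph over `[x₀, x_N]` of total oscillation `O_p` at level `p` meets a number of squares of side
  about `N ^ (-p)` comparable to `N ^ p (1 + O_p)`.
-/

noncomputable section

namespace FIF

/-! ### Functions with Lipschitz logarithm -/

/-- `φ` is positive on `E` and its logarithm is `Λ`-Lipschitz there, written without the
logarithm. -/
structure LogLipOn {X : Type*} [PseudoMetricSpace X] (Λ : NNReal) (E : Set X) (φ : X → ℝ) :
    Prop where
  pos : ∀ s ∈ E, 0 < φ s
  le_exp_mul : ∀ s ∈ E, ∀ t ∈ E, φ s ≤ Real.exp (Λ * dist s t) * φ t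

namespace LogLipOn

variable {X Y : Type*} [PseudoMetricSpace X] [PseudoMetricSpace Y] {Λ Λ' K : NNReal} {E : Set X}
  {φ ψ : X → ℝ}

lemma mono (h : LogLipOn Λ E φ) (hΛ : Λ ≤ Λ') : LogLipOn Λ' E φ where
  pos := h.pos
  le_exp_mul s hs t ht := (h.le_exp_mul s hs t ht).trans <| by
    have := h.pos t ht
    gcongr

lemma le_exp_mul_of_dist_le (h : LogLipOn Λ E φ) {s t : X} (hs : s ∈ E) (ht : t ∈ E) {d : ℝ}
    (hd : dist s t ≤ d) : φ s ≤ Real.exp (Λ * d) * φ t :=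
  (h.le_exp_mul s hs t ht).trans <| by
    have := h.pos t ht
    gcongr

lemma const {r : ℝ} (hr : 0 < r) : LogLipOn Λ E fun _ => r where
  pos _ _ := hr
  le_exp_mul _ _ _ _ := le_mul_of_one_le_left hr.le (Real.one_le_exp (by positivity))

lemma mul (hφ : LogLipOn Λ E φ) (hψ : LogLipOn Λ' E ψ) :
    LogLipOn (Λ + Λ') E fun s => φ s * ψ s where
  pos s hs := mul_pos (hφ.pos s hs) (hψ.pos s hs)
  le_exp_mul s hs t ht := by
    calc φ s * ψ s ≤ (Real.exp (Λ * dist s t) * φ t) * (Real.exp (Λ' * dist s t) * ψ t) :=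
          mul_le_mul (hφ.le_exp_mul s hs t ht) (hψ.le_exp_mul s hs t ht) (hψ.pos s hs).le
            (mul_pos (Real.exp_pos _) (hφ.pos t ht)).le
      _ = Real.exp (↑(Λ + Λ') * dist s t) * (φ t * ψ t) := by
          rw [NNReal.coe_add, add_mul, Real.exp_add]
          ring

lemma const_mul {r : ℝ} (hr : 0 < r) (h : LogLipOn Λ E φ) : LogLipOn Λ E fun s => r * φ s := by
  simpa only [zero_add] using (const (Λ := 0) hr).mul h

lemma sum {ι : Type*} {u : Finset ι} {φ : ι → X → ℝ} (hu : u.Nonempty)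
    (h : ∀ i ∈ u, LogLipOn Λ E (φ i)) : LogLipOn Λ E fun s => ∑ i ∈ u, φ i s where
  pos s hs := Finset.sum_pos (fun i hi => (h i hi).pos s hs) hu
  le_exp_mul s hs t ht := by
    rw [Finset.mul_sum]
    exact Finset.sum_le_sum fun i hi => (h i hi).le_exp_mul s hs t ht

lemma comp {g : Y → X} {E' : Set Y} (h : LogLipOn Λ E φ) (hg : LipschitzOnWith K g E')
    (hE : Set.MapsTo g E' E) : LogLipOn (Λ * K) E' (φ ∘ g) where
  pos s hs := h.pos _ (hE hs)
  le_exp_mul s hs t ht := by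
    rw [NNReal.coe_mul, mul_assoc]
    exact h.le_exp_mul_of_dist_le (hE hs) (hE ht) (hg.dist_le_mul s hs t ht)

lemma le_exp_diam_mul (h : LogLipOn Λ E φ) (hE : Bornology.IsBounded E) {s t : X} (hs : s ∈ E)
    (ht : t ∈ E) : φ s ≤ Real.exp (Λ * Metric.diam E) * φ t :=
  h.le_exp_mul_of_dist_le hs ht (Metric.dist_le_diam_of_mem hE hs ht)

lemma exists_bounds (h : LogLipOn Λ E φ) (hE : Bornology.IsBounded E) :
    ∃ m M : ℝ, 0 < m ∧ ∀ t ∈ E, m ≤ φ t ∧ φ t ≤ M := by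
  rcases E.eq_empty_or_nonempty with rfl | ⟨s, hs⟩
  · exact ⟨1, 1, one_pos, by simp⟩
  · refine ⟨(Real.exp (Λ * Metric.diam E))⁻¹ * φ s, Real.exp (Λ * Metric.diam E) * φ s,
      mul_pos (inv_pos.2 (Real.exp_pos _)) (h.pos s hs), fun t ht =>
      ⟨?_, h.le_exp_diam_mul hE ht hs⟩⟩
    exact (inv_mul_le_iff₀ (Real.exp_pos _)).2 (h.le_exp_diam_mul hE hs ht)

end LogLipOn

lemma exists_logLipOn_of_lipschitzOnWith {X : Type*} [PseudoMetricSpace X] {K : NNReal}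
    {E : Set X} {φ : X → ℝ} (hE : IsCompact E) (hK : LipschitzOnWith K φ E)
    (hpos : ∀ t ∈ E, 0 < φ t) : ∃ Λ, LogLipOn Λ E φ := by
  obtain ⟨m, hm, hmφ⟩ := hE.exists_forall_le' hK.continuousOn hpos
  lift m to NNReal using hm.le
  refine ⟨K / m, hpos, fun s hs t ht => ?_⟩
  set d := dist s t
  have hm' : (m : ℝ) ≠ 0 := hm.ne'
  calc φ s ≤ φ t + K * d := by
        linarith [le_abs_self (φ s - φ t),
          (Real.dist_eq _ _).symm.trans_le (hK.dist_le_mul s hs t ht)]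
    _ = φ t + K / m * d * m := by field_simp
    _ ≤ φ t + K / m * d * φ t := by gcongr; exact hmφ t ht
    _ = (K / m * d + 1) * φ t := by ring
    _ ≤ Real.exp (K / m * d) * φ t :=
        mul_le_mul_of_nonneg_right (Real.add_one_le_exp _) (hpos t ht).le

/-! ### The transfer operator -/

/-- The affine map of `[a, c]` onto the `i`-th (counted from `0`) of its `N` equal parts. -/
def branch (N : ℕ) (a c : ℝ) (i : ℕ) (t : ℝ) : ℝ :=
  a + (i : ℝ) / N * (c - a) + (t - a) / N

/-- The transfer operator with weight `S` of the inverse branches `branch N a c i`, `i < N`. -/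
def transferOp (N : ℕ) (a c : ℝ) (S φ : ℝ → ℝ) (t : ℝ) : ℝ :=
  ∑ i ∈ Finset.range N, S (branch N a c i t) * φ (branch N a c i t)

/-- The iterates of the transfer operator on the constant function `1`. -/
def transferIter (N : ℕ) (a c : ℝ) (S : ℝ → ℝ) (n : ℕ) : ℝ → ℝ :=
  (transferOp N a c S)^[n] fun _ => 1

section TransferOperator

variable {N : ℕ} {a c r : ℝ} {S : ℝ → ℝ} {Λ : NNReal}

lemma branch_zero_left : branch N a c 0 a = a := by simp [branch]

lemma branch_sub_branch (i : ℕ) (s t : ℝ) :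
    branch N a c i s - branch N a c i t = (s - t) / N := by
  unfold branch; ring

lemma dist_branch (i : ℕ) (s t : ℝ) :
    dist (branch N a c i s) (branch N a c i t) = dist s t / N := by
  rw [Real.dist_eq, branch_sub_branch, abs_div, Nat.abs_cast, Real.dist_eq]

lemma lipschitzWith_branch (i : ℕ) : LipschitzWith (N : NNReal)⁻¹ (branch N a c i) :=
  LipschitzWith.of_dist_le_mul fun s t => by
    rw [dist_branch, NNReal.coe_inv, NNReal.coe_natCast, div_eq_inv_mul]

lemma branch_mem_Icc {i : ℕ} (hi : i < N) {t : ℝ} (ht : t ∈ Set.Icc a c) :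
    branch N a c i t ∈ Set.Icc a c := by
  have hN : (0 : ℝ) < N := by exact_mod_cast Nat.zero_lt_of_lt hi
  have hi' : (i : ℝ) + 1 ≤ N := by exact_mod_cast hi
  have hac : 0 ≤ c - a := sub_nonneg.2 (ht.1.trans ht.2)
  have heq : branch N a c i t = a + (i * (c - a) + (t - a)) / N := by
    unfold branch; ring
  rw [heq]
  refine ⟨le_add_of_nonneg_right (div_nonneg ?_ hN.le), ?_⟩
  · exact add_nonneg (by positivity) (sub_nonneg.2 ht.1)
  · rw [← le_sub_iff_add_le', div_le_iff₀ hN]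
    nlinarith [ht.2]

lemma LogLipOn.transferOp {φ : ℝ → ℝ} (hN : 2 ≤ N) (hS : LogLipOn Λ (Set.Icc a c) S)
    (hφ : LogLipOn Λ (Set.Icc a c) φ) : LogLipOn Λ (Set.Icc a c) (transferOp N a c S φ) := by
  have hΛ : (Λ + Λ) * (N : NNReal)⁻¹ ≤ Λ := by
    have hN' : (2 : NNReal) ≤ N := by exact_mod_cast hN
    calc (Λ + Λ) * (N : NNReal)⁻¹ ≤ (Λ + Λ) * 2⁻¹ := by gcongr
      _ = Λ := by rw [← two_mul, mul_right_comm, mul_inv_cancel₀ two_ne_zero, one_mul]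
  exact LogLipOn.sum (Finset.nonempty_range_iff.2 (by omega)) fun i hi =>
    ((hS.mul hφ).comp (lipschitzWith_branch i).lipschitzOnWith fun _ ht =>
      branch_mem_Icc (Finset.mem_range.1 hi) ht).mono hΛ

lemma transferIter_succ (n : ℕ) :
    transferIter N a c S (n + 1) = transferOp N a c S (transferIter N a c S n) :=
  Function.iterate_succ_apply' _ _ _

lemma LogLipOn.transferIter (hN : 2 ≤ N) (hS : LogLipOn Λ (Set.Icc a c) S) (n : ℕ) :
    LogLipOn Λ (Set.Icc a c) (transferIter N a c S n) := by
  induction n with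
  | zero => exact LogLipOn.const one_pos
  | succ n ih =>
    rw [transferIter_succ]
    exact hS.transferOp hN ih

lemma transferOp_sum_mul {ι : Type*} (u : Finset ι) (w : ι → ℝ) (φ : ι → ℝ → ℝ) (t : ℝ) :
    transferOp N a c S (fun s => ∑ j ∈ u, w j * φ j s) t =
      ∑ j ∈ u, w j * transferOp N a c S (φ j) t := by
  simp only [transferOp, Finset.mul_sum]
  rw [Finset.sum_comm]
  exact Finset.sum_congr rfl fun j _ => Finset.sum_congr rfl fun i _ => by ring

/-- The truncated Neumann series `∑ k < n, r⁻ᵏ Tᵏ 1` of the transfer operator `T`, which is a super-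
or subeigenfunction for `r` according to the sign of `r ^ n - T ^ n 1`. -/
def neumannSum (N : ℕ) (a c : ℝ) (S : ℝ → ℝ) (r : ℝ) (n : ℕ) (t : ℝ) : ℝ :=
  ∑ k ∈ Finset.range n, r⁻¹ ^ k * transferIter N a c S k t

lemma LogLipOn.neumannSum (hN : 2 ≤ N) (hS : LogLipOn Λ (Set.Icc a c) S) (hr : 0 < r) {n : ℕ}
    (hn : n ≠ 0) : LogLipOn Λ (Set.Icc a c) (neumannSum N a c S r n) :=
  LogLipOn.sum (Finset.nonempty_range_iff.2 hn) fun k _ =>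
    (hS.transferIter hN k).const_mul (by positivity)

lemma transferOp_neumannSum (hr : r ≠ 0) (n : ℕ) (t : ℝ) :
    transferOp N a c S (neumannSum N a c S r n) t =
      r * neumannSum N a c S r n t + r * (r⁻¹ ^ n * transferIter N a c S n t - 1) := by
  have hshift : transferOp N a c S (neumannSum N a c S r n) t =
      r * ∑ k ∈ Finset.range n, r⁻¹ ^ (k + 1) * transferIter N a c S (k + 1) t := by
    unfold neumannSum
    rw [transferOp_sum_mul, Finset.mul_sum]
    refine Finset.sum_congr rfl fun k _ => ?_
    rw [transferIter_succ, pow_succ']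
    field_simp
  have htelescope := Finset.sum_range_succ (fun k => r⁻¹ ^ k * transferIter N a c S k t) n
  rw [Finset.sum_range_succ'] at htelescope
  have hzero : transferIter N a c S 0 t = 1 := rfl
  rw [hzero] at htelescope
  rw [hshift, neumannSum]
  linear_combination r * htelescope

/-! ### The leading eigenvalue -/

/-- `r` admits a positive supereigenfunction `φ` of the transfer operator, with `Λ`-Lipschitz
logarithm. -/
def IsSupereigenvalue (N : ℕ) (a c : ℝ) (S : ℝ → ℝ) (Λ : NNReal) (r : ℝ) : Prop :=
  ∃ φ, LogLipOn Λ (Set.Icc a c) φ ∧ ∀ t ∈ Set.Icc a c, transferOp N a c S φ t ≤ r * φ t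

/-- `r` admits a positive subeigenfunction `φ` of the transfer operator, with `Λ`-Lipschitz
logarithm. -/
def IsSubeigenvalue (N : ℕ) (a c : ℝ) (S : ℝ → ℝ) (Λ : NNReal) (r : ℝ) : Prop :=
  ∃ φ, LogLipOn Λ (Set.Icc a c) φ ∧ ∀ t ∈ Set.Icc a c, r * φ t ≤ transferOp N a c S φ t

/-- `ρ` separates the subeigenvalues of the transfer operator from its supereigenvalues. This
replaces the existence of an eigenfunction for its leading eigenvalue. -/
structure IsLeadingEigenvalue (N : ℕ) (a c : ℝ) (S : ℝ → ℝ) (Λ : NNReal) (ρ : ℝ) : Prop where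
  pos : 0 < ρ
  isSubeigenvalue : ∀ r, 0 < r → r < ρ → IsSubeigenvalue N a c S Λ r
  isSupereigenvalue : ∀ r, ρ < r → IsSupereigenvalue N a c S Λ r

lemma IsSupereigenvalue.mono {r' : ℝ} (h : IsSupereigenvalue N a c S Λ r) (hr : r ≤ r') :
    IsSupereigenvalue N a c S Λ r' := by
  obtain ⟨φ, hφ, hle⟩ := h
  exact ⟨φ, hφ, fun t ht => (hle t ht).trans (mul_le_mul_of_nonneg_right hr (hφ.pos t ht).le)⟩

lemma isSupereigenvalue_of_transferIter_le (hN : 2 ≤ N) (hS : LogLipOn Λ (Set.Icc a c) S)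
    (hr : 0 < r) {n : ℕ} (hn : n ≠ 0) (h : ∀ t ∈ Set.Icc a c, transferIter N a c S n t ≤ r ^ n) :
    IsSupereigenvalue N a c S Λ r := by
  refine ⟨_, hS.neumannSum hN hr hn, fun t ht => ?_⟩
  rw [transferOp_neumannSum hr.ne', add_le_iff_nonpos_right, inv_pow]
  refine mul_nonpos_of_nonneg_of_nonpos hr.le (sub_nonpos.2 ?_)
  exact (inv_mul_le_iff₀ (pow_pos hr n)).2 ((h t ht).trans_eq (mul_one _).symm)

lemma isSubeigenvalue_of_le_transferIter (hN : 2 ≤ N) (hS : LogLipOn Λ (Set.Icc a c) S)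
    (hr : 0 < r) {n : ℕ} (hn : n ≠ 0) (h : ∀ t ∈ Set.Icc a c, r ^ n ≤ transferIter N a c S n t) :
    IsSubeigenvalue N a c S Λ r := by
  refine ⟨_, hS.neumannSum hN hr hn, fun t ht => ?_⟩
  rw [transferOp_neumannSum hr.ne', le_add_iff_nonneg_right, inv_pow]
  refine mul_nonneg hr.le (sub_nonneg.2 ?_)
  exact (le_inv_mul_iff₀ (pow_pos hr n)).2 ((mul_one _).trans_le (h t ht))

lemma exists_isSupereigenvalue (hN : 2 ≤ N) (hS : LogLipOn Λ (Set.Icc a c) S) :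
    ∃ r, IsSupereigenvalue N a c S Λ r := by
  have hone : LogLipOn Λ (Set.Icc a c) fun _ => (1 : ℝ) := LogLipOn.const one_pos
  obtain ⟨_, M, -, hM⟩ := (hS.transferOp hN hone).exists_bounds (Metric.isBounded_Icc a c)
  exact ⟨M, _, hone, fun t ht => (hM t ht).2.trans_eq (mul_one M).symm⟩

lemma IsSupereigenvalue.apply_left_le (hN : 0 < N) (hac : a ≤ c)
    (hS : ∀ t ∈ Set.Icc a c, 0 ≤ S t) (h : IsSupereigenvalue N a c S Λ r) : S a ≤ r := by
  obtain ⟨φ, hφ, hle⟩ := h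
  have ha : a ∈ Set.Icc a c := Set.left_mem_Icc.2 hac
  refine le_of_mul_le_mul_right (le_trans ?_ (hle a ha)) (hφ.pos a ha)
  have hterm := Finset.single_le_sum (f := fun i => S (branch N a c i a) * φ (branch N a c i a))
    (fun i hi => by
      have hmem := branch_mem_Icc (Finset.mem_range.1 hi) ha
      exact mul_nonneg (hS _ hmem) (hφ.pos _ hmem).le) (Finset.mem_range.2 hN)
  simpa only [branch_zero_left, transferOp] using hterm

lemma isSubeigenvalue_of_not_isSupereigenvalue (hN : 2 ≤ N) (hS : LogLipOn Λ (Set.Icc a c) S)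
    {r' : ℝ} (hr : 0 < r) (hrr' : r < r') (h : ¬ IsSupereigenvalue N a c S Λ r') :
    IsSubeigenvalue N a c S Λ r := by
  set B := Real.exp (Λ * Metric.diam (Set.Icc a c))
  obtain ⟨n, hn⟩ := pow_unbounded_of_one_lt B ((one_lt_div hr).2 hrr')
  have hn0 : n ≠ 0 := by
    rintro rfl
    exact (Real.one_le_exp (by positivity) : 1 ≤ B).not_gt (by simpa only [pow_zero] using hn)
  obtain ⟨s, hs, hlarge⟩ : ∃ s ∈ Set.Icc a c, r' ^ n < transferIter N a c S n s := by
    by_contra! hsmall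
    exact h (isSupereigenvalue_of_transferIter_le hN hS (hr.trans hrr') hn0 hsmall)
  refine isSubeigenvalue_of_le_transferIter hN hS hr hn0 fun t ht => ?_
  refine le_of_mul_le_mul_left ?_ (Real.exp_pos _ : 0 < B)
  calc B * r ^ n ≤ (r' / r) ^ n * r ^ n := by gcongr
    _ = r' ^ n := by rw [← mul_pow, div_mul_cancel₀ _ hr.ne']
    _ ≤ transferIter N a c S n s := hlarge.le
    _ ≤ B * transferIter N a c S n t :=
        (hS.transferIter hN n).le_exp_diam_mul (Metric.isBounded_Icc a c) hs ht

theorem exists_isLeadingEigenvalue (hN : 2 ≤ N) (hac : a ≤ c)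
    (hS : LogLipOn Λ (Set.Icc a c) S) : ∃ ρ, IsLeadingEigenvalue N a c S Λ ρ := by
  have hlower : S a ∈ lowerBounds {r | IsSupereigenvalue N a c S Λ r} := fun r hr =>
    hr.apply_left_le (by omega) hac fun t ht => (hS.pos t ht).le
  have hne : {r | IsSupereigenvalue N a c S Λ r}.Nonempty := exists_isSupereigenvalue hN hS
  refine ⟨sInf {r | IsSupereigenvalue N a c S Λ r}, ?_, fun r hr hrρ => ?_, fun r hρr => ?_⟩
  · exact (hS.pos a (Set.left_mem_Icc.2 hac)).trans_le (le_csInf hne hlower)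
  · obtain ⟨r', hrr', hr'ρ⟩ := exists_between hrρ
    exact isSubeigenvalue_of_not_isSupereigenvalue hN hS hr hrr' fun h =>
      hr'ρ.not_ge (csInf_le ⟨_, hlower⟩ h)
  · obtain ⟨r', hr', hr'r⟩ := exists_lt_of_csInf_lt hne hρr
    exact IsSupereigenvalue.mono hr' hr'r.le

end TransferOperator

/-! ### Spectral radii of nonnegative matrices -/

section NonnegativeMatrix

open scoped Matrix

variable {ι : Type*} [Fintype ι] {X : Matrix ι ι ℝ} {g : ι → ℝ} {r : ℝ}

lemma vecMul_mono_of_nonneg (hX : ∀ i j, 0 ≤ X i j) : Monotone fun g : ι → ℝ => g ᵥ* X :=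
  fun _ _ hgg' j => dotProduct_le_dotProduct_of_nonneg_right hgg' fun i => hX i j

lemma pow_smul_le_vecMul_pow [DecidableEq ι] (hX : ∀ i j, 0 ≤ X i j) (hr : 0 ≤ r)
    (h : r • g ≤ g ᵥ* X) (k : ℕ) : r ^ k • g ≤ g ᵥ* X ^ k := by
  induction k with
  | zero => simp
  | succ k ih =>
    calc r ^ (k + 1) • g = r ^ k • r • g := by rw [pow_succ, mul_smul]
      _ ≤ r ^ k • (g ᵥ* X) := smul_le_smul_of_nonneg_left h (by positivity)
      _ = (r ^ k • g) ᵥ* X := (Matrix.smul_vecMul _ _ _).symm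
      _ ≤ (g ᵥ* X ^ k) ᵥ* X := vecMul_mono_of_nonneg hX ih
      _ = g ᵥ* X ^ (k + 1) := by rw [Matrix.vecMul_vecMul, pow_succ]

lemma norm_mul_norm_le_mulVec_norm (hX : ∀ i j, 0 ≤ X i j) {μ : ℂ} {v : ι → ℂ}
    (hv : X.map (fun t : ℝ => (t : ℂ)) *ᵥ v = μ • v) :
    ‖μ‖ • (fun i => ‖v i‖) ≤ X *ᵥ fun i => ‖v i‖ := fun i => by
  calc ‖μ‖ * ‖v i‖ = ‖(X.map (fun t : ℝ => (t : ℂ)) *ᵥ v) i‖ := by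
        rw [hv, Pi.smul_apply, norm_smul]
    _ ≤ ∑ j, ‖(X i j : ℂ) * v j‖ := norm_sum_le _ _
    _ = ∑ j, X i j * ‖v j‖ := by
        simp only [norm_mul, Complex.norm_real, Real.norm_of_nonneg (hX i _)]

lemma spectralRadius_map_le_ofReal [DecidableEq ι] (hX : ∀ i j, 0 ≤ X i j) (hg : ∀ i, 0 < g i)
    (h : g ᵥ* X ≤ r • g) :
    spectralRadius ℂ (X.map fun t : ℝ => (t : ℂ)) ≤ ENNReal.ofReal r := by
  refine iSup₂_le fun μ hμ => ?_
  rw [← Matrix.spectrum_toLin', ← Module.End.hasEigenvalue_iff_mem_spectrum] at hμ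
  obtain ⟨v, hv⟩ := hμ.exists_hasEigenvector
  set w : ι → ℝ := fun i => ‖v i‖
  have hw : 0 ≤ w := fun i => norm_nonneg _
  have hμw : ‖μ‖ • w ≤ X *ᵥ w :=
    norm_mul_norm_le_mulVec_norm hX ((Matrix.toLin'_apply _ _).symm.trans hv.apply_eq_smul)
  obtain ⟨i, hi⟩ := Function.ne_iff.1 hv.2
  have hgw : 0 < g ⬝ᵥ w := Finset.sum_pos' (fun i _ => mul_nonneg (hg i).le (hw i))
    ⟨i, Finset.mem_univ _, mul_pos (hg i) (norm_pos_iff.2 hi)⟩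
  have hle : ‖μ‖ * (g ⬝ᵥ w) ≤ r * (g ⬝ᵥ w) := by
    calc ‖μ‖ * (g ⬝ᵥ w) = g ⬝ᵥ ‖μ‖ • w := by rw [dotProduct_smul, smul_eq_mul]
      _ ≤ g ⬝ᵥ X *ᵥ w := dotProduct_le_dotProduct_of_nonneg_left hμw fun i => (hg i).le
      _ = g ᵥ* X ⬝ᵥ w := Matrix.dotProduct_mulVec _ _ _
      _ ≤ r • g ⬝ᵥ w := dotProduct_le_dotProduct_of_nonneg_right h hw
      _ = r * (g ⬝ᵥ w) := by rw [smul_dotProduct, smul_eq_mul]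
  exact (ofReal_norm μ).symm.trans_le
    (ENNReal.ofReal_le_ofReal (le_of_mul_le_mul_right hle hgw))

section Gelfand

attribute [local instance] Matrix.linftyOpNormedRing Matrix.linftyOpNormedAlgebra

lemma pow_le_norm_map_pow [DecidableEq ι] (hX : ∀ i j, 0 ≤ X i j) (hg : 0 < g) (hr : 0 ≤ r)
    (h : r • g ≤ g ᵥ* X) (k : ℕ) : r ^ k ≤ ‖X.map (fun t : ℝ => (t : ℂ)) ^ k‖ := by
  set Y : Matrix ι ι ℂ := X.map fun t : ℝ => (t : ℂ)
  have hYpow : Y ^ k = (X ^ k).map fun t : ℝ => (t : ℂ) :=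
    (Matrix.map_pow X Complex.ofRealHom k).symm
  obtain ⟨hg0, i, hi⟩ := Pi.lt_def.1 hg
  have hsum : 0 < g ⬝ᵥ 1 := Finset.sum_pos' (fun i _ => by simpa using hg0 i)
    ⟨i, Finset.mem_univ _, by simpa using hi⟩
  have hrow : X ^ k *ᵥ 1 ≤ ‖Y ^ k‖ • (1 : ι → ℝ) := fun i => by
    have hcast : (Y ^ k *ᵥ 1) i = (((X ^ k *ᵥ 1) i : ℝ) : ℂ) := by
      simp [hYpow, Matrix.mulVec, dotProduct]
    calc (X ^ k *ᵥ 1) i ≤ ‖(Y ^ k *ᵥ 1) i‖ := by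
          rw [hcast, Complex.norm_real]
          exact le_abs_self _
      _ ≤ ‖Y ^ k *ᵥ 1‖ := norm_le_pi_norm _ i
      _ ≤ ‖Y ^ k‖ * ‖(1 : ι → ℂ)‖ := Matrix.linfty_opNorm_mulVec _ _
      _ ≤ ‖Y ^ k‖ * 1 := by
          gcongr
          exact (pi_norm_const_le (1 : ℂ)).trans_eq norm_one
  refine le_of_mul_le_mul_right ?_ hsum
  calc r ^ k * (g ⬝ᵥ 1) = r ^ k • g ⬝ᵥ 1 := by rw [smul_dotProduct, smul_eq_mul]
    _ ≤ g ᵥ* X ^ k ⬝ᵥ 1 := dotProduct_le_dotProduct_of_nonneg_right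
        (pow_smul_le_vecMul_pow hX hr h k) zero_le_one
    _ = g ⬝ᵥ X ^ k *ᵥ 1 := (Matrix.dotProduct_mulVec _ _ _).symm
    _ ≤ g ⬝ᵥ ‖Y ^ k‖ • 1 := dotProduct_le_dotProduct_of_nonneg_left hrow hg0
    _ = ‖Y ^ k‖ * (g ⬝ᵥ 1) := by rw [dotProduct_smul, smul_eq_mul]

lemma ofReal_le_spectralRadius_map [DecidableEq ι] (hX : ∀ i j, 0 ≤ X i j) (hg : 0 < g)
    (hr : 0 ≤ r) (h : r • g ≤ g ᵥ* X) :
    ENNReal.ofReal r ≤ spectralRadius ℂ (X.map fun t : ℝ => (t : ℂ)) := by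
  refine ge_of_tendsto (spectrum.pow_norm_pow_one_div_tendsto_nhds_spectralRadius _) ?_
  filter_upwards [eventually_ne_atTop 0] with k hk
  refine ENNReal.ofReal_le_ofReal ?_
  calc r = (r ^ k) ^ (1 / k : ℝ) := by rw [one_div, Real.pow_rpow_inv_natCast hr hk]
    _ ≤ _ := by
        gcongr
        exact pow_le_norm_map_pow hX hg hr h k

lemma spectralRadius_ne_top [DecidableEq ι] [Nonempty ι] (Y : Matrix ι ι ℂ) :
    spectralRadius ℂ Y ≠ ⊤ := by
  obtain ⟨μ, -, hμ⟩ := spectrum.exists_nnnorm_eq_spectralRadius Y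
  exact hμ ▸ ENNReal.coe_ne_top

end Gelfand

end NonnegativeMatrix

lemma matrixSpectralRadius_le {n : ℕ} {X : Matrix (Fin n) (Fin n) ℝ} {g : Fin n → ℝ} {r : ℝ}
    (hX : ∀ i j, 0 ≤ X i j) (hg : ∀ i, 0 < g i) (hr : 0 ≤ r) (h : Matrix.vecMul g X ≤ r • g) :
    matrixSpectralRadius X ≤ r :=
  ENNReal.toReal_le_of_le_ofReal hr (spectralRadius_map_le_ofReal hX hg h)

lemma le_matrixSpectralRadius {n : ℕ} {X : Matrix (Fin n) (Fin n) ℝ} {g : Fin n → ℝ} {r : ℝ}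
    (hX : ∀ i j, 0 ≤ X i j) (hg : 0 < g) (hr : 0 ≤ r) (h : r • g ≤ Matrix.vecMul g X) :
    r ≤ matrixSpectralRadius X := by
  have : Nonempty (Fin n) := (Pi.lt_def.1 hg).2.nonempty
  exact (ENNReal.ofReal_le_iff_le_toReal (spectralRadius_ne_top _)).1
    (ofReal_le_spectralRadius_map hX hg hr h)

/-! ### Subdivision of an interval -/

lemma sum_range_mul {M : Type*} [AddCommMonoid M] (m n : ℕ) (F : ℕ → M) :
    ∑ r ∈ Finset.range (m * n), F r =
      ∑ i ∈ Finset.range m, ∑ l ∈ Finset.range n, F (i * n + l) := by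
  induction m with
  | zero => simp
  | succ m ih => rw [Nat.succ_mul, Finset.sum_range_add, ih, Finset.sum_range_succ]

lemma mul_pow_add_lt_pow_succ {N k i j : ℕ} (hi : i < N) (hj : j < N ^ k) :
    i * N ^ k + j < N ^ (k + 1) :=
  calc i * N ^ k + j < (i + 1) * N ^ k := by rw [Nat.succ_mul]; omega
    _ ≤ N ^ (k + 1) := by rw [pow_succ']; exact Nat.mul_le_mul_right _ hi

/-- The left end point of the `j`-th (counted from `0`) of the `N ^ k` equal parts of `[a, c]`. -/
def leftPt (N : ℕ) (a c : ℝ) (k j : ℕ) : ℝ :=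
  a + (j : ℝ) / (N : ℝ) ^ k * (c - a)

section Subdivision

variable {N : ℕ} {a c : ℝ} {k i j : ℕ}

lemma leftPt_zero : leftPt N a c k 0 = a := by simp [leftPt]

lemma leftPt_pow (hN : 0 < N) : leftPt N a c k (N ^ k) = c := by
  have : (N : ℝ) ≠ 0 := by positivity
  simp [leftPt, this]

lemma leftPt_succ : leftPt N a c k (j + 1) = leftPt N a c k j + (c - a) / (N : ℝ) ^ k := by
  unfold leftPt; push_cast; ring

lemma leftPt_mul (hN : 0 < N) : leftPt N a c (k + 1) (j * N) = leftPt N a c k j := by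
  have : (N : ℝ) ≠ 0 := by positivity
  rw [leftPt, leftPt, Nat.cast_mul, pow_succ, mul_div_mul_right _ _ this]

lemma branch_leftPt (hN : 0 < N) :
    branch N a c i (leftPt N a c k j) = leftPt N a c (k + 1) (i * N ^ k + j) := by
  unfold branch leftPt
  push_cast
  field_simp
  ring

lemma leftPt_mono (hac : a ≤ c) : Monotone (leftPt N a c k) := fun i j hij => by
  have := sub_nonneg.2 hac
  unfold leftPt
  gcongr

lemma leftPt_mem_Icc (hN : 0 < N) (hac : a ≤ c) (hj : j ≤ N ^ k) :
    leftPt N a c k j ∈ Set.Icc a c :=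
  ⟨leftPt_zero.symm.trans_le (leftPt_mono hac (Nat.zero_le j)),
    (leftPt_mono hac hj).trans_eq (leftPt_pow hN)⟩

lemma subInterval_eq_Icc :
    subInterval N a c k j = Set.Icc (leftPt N a c k j) (leftPt N a c k (j + 1)) := by
  simp [subInterval, leftPt]

lemma isCompact_subInterval : IsCompact (subInterval N a c k j) := isCompact_Icc

lemma leftPt_mem_subInterval (hac : a ≤ c) : leftPt N a c k j ∈ subInterval N a c k j := by
  rw [subInterval_eq_Icc]
  exact Set.left_mem_Icc.2 (leftPt_mono hac (Nat.le_succ j))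

lemma dist_le_of_mem_subInterval {s t : ℝ} (hs : s ∈ subInterval N a c k j)
    (ht : t ∈ subInterval N a c k j) : dist s t ≤ (c - a) / (N : ℝ) ^ k := by
  rw [subInterval_eq_Icc] at hs ht
  exact (Real.dist_le_of_mem_Icc hs ht).trans_eq (by rw [leftPt_succ, add_sub_cancel_left])

lemma subInterval_succ_subset (hN : 0 < N) (hac : a ≤ c) (m : ℕ) :
    subInterval N a c (k + 1) m ⊆ subInterval N a c k (m / N) := by
  rw [subInterval_eq_Icc, subInterval_eq_Icc, ← leftPt_mul hN (j := m / N),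
    ← leftPt_mul hN (j := m / N + 1)]
  refine Set.Icc_subset_Icc (leftPt_mono hac (Nat.div_mul_le_self m N)) (leftPt_mono hac ?_)
  rw [mul_comm]
  exact Nat.lt_mul_div_succ m hN

lemma subInterval_subset_Icc (hN : 0 < N) (hac : a ≤ c) (hj : j < N ^ k) :
    subInterval N a c k j ⊆ Set.Icc a c := by
  rw [subInterval_eq_Icc]
  exact Set.Icc_subset_Icc (leftPt_mem_Icc hN hac hj.le).1 (leftPt_mem_Icc hN hac hj).2

lemma subSubInterval_eq_subInterval (hN : 0 < N) :
    subSubInterval N a c k i j = subInterval N a c (k + 1) (i * N ^ k + j) := by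
  have : (N : ℝ) ≠ 0 := by positivity
  unfold subSubInterval subInterval
  push_cast
  congr 1 <;> field_simp <;> ring

lemma subSubInterval_succ_subset (hN : 0 < N) (hac : a ≤ c) :
    subSubInterval N a c (k + 1) i j ⊆ subInterval N a c (k + 1) (i * N ^ k + j / N) := by
  rw [subSubInterval_eq_subInterval hN]
  refine (subInterval_succ_subset hN hac _).trans_eq ?_
  rw [pow_succ, ← mul_assoc, mul_comm _ N, Nat.mul_add_div hN]

lemma branch_leftPt_mem_subSubInterval (hN : 0 < N) (hac : a ≤ c) :
    branch N a c i (leftPt N a c k j) ∈ subSubInterval N a c k i j := by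
  rw [branch_leftPt hN, subSubInterval_eq_subInterval hN]
  exact leftPt_mem_subInterval hac

end Subdivision

/-! ### Spectral radii of the vertical scaling matrices -/

lemma LogLipOn.mul_le_exp_mul {X : Type*} [PseudoMetricSpace X] {Λ : NNReal} {E : Set X}
    {φ ψ : X → ℝ} (hφ : LogLipOn Λ E φ) (hψ : LogLipOn Λ E ψ) {s s' t t' : X} (hs : s ∈ E)
    (hs' : s' ∈ E) (ht : t ∈ E) (ht' : t' ∈ E) {d : ℝ} (hd : dist s s' ≤ d) (hd' : dist t t' ≤ d) :
    φ s * ψ t ≤ Real.exp (2 * Λ * d) * (φ s' * ψ t') := by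
  calc φ s * ψ t ≤ (Real.exp (Λ * d) * φ s') * (Real.exp (Λ * d) * ψ t') :=
        mul_le_mul (hφ.le_exp_mul_of_dist_le hs hs' hd) (hψ.le_exp_mul_of_dist_le ht ht' hd')
          (hψ.pos t ht).le (mul_pos (Real.exp_pos _) (hφ.pos s' hs')).le
    _ = Real.exp (2 * Λ * d) * (φ s' * ψ t') := by
        rw [mul_assoc 2, two_mul, Real.exp_add]
        ring

lemma vecMul_scalingPattern {N k : ℕ} (hN : 0 < N) (s : ℕ → ℕ → ℝ) (g : ℕ → ℝ)
    (j : Fin (N ^ (k + 1))) :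
    Matrix.vecMul (fun r : Fin (N ^ (k + 1)) => g r) (scalingPattern N (k + 1) s) j =
      ∑ i ∈ Finset.range N, g (i * N ^ k + j / N) * s i j := by
  set F : ℕ → ℝ := fun r => g r *
    if r % N ^ k * N ≤ j ∧ j < (r % N ^ k + 1) * N then s (r / N ^ k) j else 0 with hF
  have hsum : Matrix.vecMul (fun r : Fin (N ^ (k + 1)) => g r) (scalingPattern N (k + 1) s) j =
      ∑ i ∈ Finset.range N, ∑ l ∈ Finset.range (N ^ k), F (i * N ^ k + l) := by
    rw [← sum_range_mul, ← pow_succ', ← Fin.sum_univ_eq_sum_range]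
    simp [hF, scalingPattern, Matrix.vecMul, dotProduct]
  have hj : (j : ℕ) / N < N ^ k := (Nat.div_lt_iff_lt_mul hN).2 (j.2.trans_eq (pow_succ N k))
  have hF_apply : ∀ i, ∀ l < N ^ k, F (i * N ^ k + l) =
      if l * N ≤ j ∧ j < (l + 1) * N then g (i * N ^ k + l) * s i j else 0 := fun i l hl => by
    have hmod : (i * N ^ k + l) % N ^ k = l := by rw [Nat.mul_add_mod', Nat.mod_eq_of_lt hl]
    have hdiv : (i * N ^ k + l) / N ^ k = i := by
      rw [mul_comm, Nat.mul_add_div (pow_pos hN k), Nat.div_eq_of_lt hl, add_zero]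
    simp only [hF, hmod, hdiv, mul_ite, mul_zero]
  rw [hsum]
  refine Finset.sum_congr rfl fun i _ => ?_
  rw [Finset.sum_eq_single_of_mem ((j : ℕ) / N) (Finset.mem_range.2 hj), hF_apply i _ hj, if_pos]
  · exact ⟨Nat.div_mul_le_self _ _, (Nat.lt_mul_div_succ _ hN).trans_eq (mul_comm _ _)⟩
  · intro l hl hne
    rw [hF_apply i l (Finset.mem_range.1 hl), if_neg]
    exact fun h => hne (Nat.div_eq_of_lt_le h.1 h.2).symm

lemma scalingPattern_nonneg {N k : ℕ} {s : ℕ → ℕ → ℝ} (hN : 0 < N)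
    (hs : ∀ i < N, ∀ j < N ^ (k + 1), 0 ≤ s i j) (r j : Fin (N ^ (k + 1))) :
    0 ≤ scalingPattern N (k + 1) s r j := by
  simp only [scalingPattern, Matrix.of_apply, Nat.add_sub_cancel]
  split_ifs
  · exact hs _ ((Nat.div_lt_iff_lt_mul (pow_pos hN k)).2 (r.2.trans_eq (pow_succ' N k))) _ j.2
  · exact le_rfl

section ScalingMatrix

variable {N : ℕ} {a c r ρ : ℝ} {S φ : ℝ → ℝ} {Λ : NNReal} {k : ℕ} {s : ℕ → ℕ → ℝ}

/-- The values of `φ` at the left end points of the `N ^ k` equal parts of `[a, c]`. -/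
def sample (N : ℕ) (a c : ℝ) (φ : ℝ → ℝ) (k : ℕ) (j : Fin (N ^ k)) : ℝ :=
  φ (leftPt N a c k j)

lemma LogLipOn.sample_pos (hN : 0 < N) (hac : a ≤ c) (hφ : LogLipOn Λ (Set.Icc a c) φ)
    (j : Fin (N ^ k)) : 0 < sample N a c φ k j :=
  hφ.pos _ (leftPt_mem_Icc hN hac j.2.le)

lemma sample_mul_comparable (hN : 0 < N) (hac : a ≤ c) (hS : LogLipOn Λ (Set.Icc a c) S)
    (hφ : LogLipOn Λ (Set.Icc a c) φ) {i j : ℕ} (hi : i < N) (hj : j < N ^ (k + 1)) {σ : ℝ}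
    (hσ : σ ∈ S '' subSubInterval N a c (k + 1) i j) :
    let p := leftPt N a c (k + 1) (i * N ^ k + j / N)
    let q := branch N a c i (leftPt N a c (k + 1) j)
    φ p * σ ≤ Real.exp (2 * Λ * ((c - a) / N ^ (k + 1))) * (S q * φ q) ∧
      S q * φ q ≤ Real.exp (2 * Λ * ((c - a) / N ^ (k + 1))) * (φ p * σ) := by
  intro p q
  obtain ⟨t, ht, rfl⟩ := hσ
  have hj' : j / N < N ^ k := (Nat.div_lt_iff_lt_mul hN).2 (hj.trans_eq (pow_succ N k))
  have hsub := subInterval_subset_Icc hN hac (mul_pow_add_lt_pow_succ hi hj')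
  have hp := leftPt_mem_subInterval (N := N) (k := k + 1) (j := i * N ^ k + j / N) hac
  have hq := subSubInterval_succ_subset hN hac (branch_leftPt_mem_subSubInterval
    (k := k + 1) (i := i) (j := j) hN hac)
  replace ht := subSubInterval_succ_subset hN hac ht
  rw [mul_comm (S q)]
  exact ⟨hφ.mul_le_exp_mul hS (hsub hp) (hsub hq) (hsub ht) (hsub hq)
      (dist_le_of_mem_subInterval hp hq) (dist_le_of_mem_subInterval ht hq),
    hφ.mul_le_exp_mul hS (hsub hq) (hsub hp) (hsub hq) (hsub ht)
      (dist_le_of_mem_subInterval hq hp) (dist_le_of_mem_subInterval hq ht)⟩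

lemma vecMul_sample_le (hN : 0 < N) (hac : a ≤ c) (hS : LogLipOn Λ (Set.Icc a c) S)
    (hs : ∀ i < N, ∀ j < N ^ (k + 1), s i j ∈ S '' subSubInterval N a c (k + 1) i j)
    (hφ : LogLipOn Λ (Set.Icc a c) φ) :
    Matrix.vecMul (sample N a c φ (k + 1)) (scalingPattern N (k + 1) s) ≤
      Real.exp (2 * Λ * ((c - a) / N ^ (k + 1))) •
        sample N a c (transferOp N a c S φ) (k + 1) := fun j => by
  refine (vecMul_scalingPattern hN s (fun m => φ (leftPt N a c (k + 1) m)) j).trans_le ?_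
  rw [Pi.smul_apply, smul_eq_mul, sample, transferOp, Finset.mul_sum]
  exact Finset.sum_le_sum fun i hi => (sample_mul_comparable hN hac hS hφ (Finset.mem_range.1 hi)
    j.2 (hs i (Finset.mem_range.1 hi) j j.2)).1

lemma sample_transferOp_le (hN : 0 < N) (hac : a ≤ c) (hS : LogLipOn Λ (Set.Icc a c) S)
    (hs : ∀ i < N, ∀ j < N ^ (k + 1), s i j ∈ S '' subSubInterval N a c (k + 1) i j)
    (hφ : LogLipOn Λ (Set.Icc a c) φ) :
    sample N a c (transferOp N a c S φ) (k + 1) ≤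
      Real.exp (2 * Λ * ((c - a) / N ^ (k + 1))) •
        Matrix.vecMul (sample N a c φ (k + 1)) (scalingPattern N (k + 1) s) := fun j => by
  refine le_of_le_of_eq ?_ (congrArg (_ * ·)
    (vecMul_scalingPattern hN s (fun m => φ (leftPt N a c (k + 1) m)) j)).symm
  rw [sample, transferOp, Finset.mul_sum]
  exact Finset.sum_le_sum fun i hi => (sample_mul_comparable hN hac hS hφ (Finset.mem_range.1 hi)
    j.2 (hs i (Finset.mem_range.1 hi) j j.2)).2

lemma scalingPattern_nonneg_of_mem_image (hN : 0 < N) (hac : a ≤ c)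
    (hS : ∀ t ∈ Set.Icc a c, 0 ≤ S t)
    (hs : ∀ i < N, ∀ j < N ^ (k + 1), s i j ∈ S '' subSubInterval N a c (k + 1) i j)
    (r j : Fin (N ^ (k + 1))) : 0 ≤ scalingPattern N (k + 1) s r j := by
  refine scalingPattern_nonneg hN (fun i hi j hj => ?_) r j
  obtain ⟨t, ht, heq⟩ := hs i hi j hj
  rw [subSubInterval_eq_subInterval hN] at ht
  exact heq ▸ hS t (subInterval_subset_Icc hN hac (mul_pow_add_lt_pow_succ hi hj) ht)

lemma IsSupereigenvalue.matrixSpectralRadius_le (h : IsSupereigenvalue N a c S Λ r) (hN : 0 < N)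
    (hac : a ≤ c) (hr : 0 ≤ r) (hS : LogLipOn Λ (Set.Icc a c) S)
    (hs : ∀ i < N, ∀ j < N ^ (k + 1), s i j ∈ S '' subSubInterval N a c (k + 1) i j) :
    matrixSpectralRadius (scalingPattern N (k + 1) s) ≤
      Real.exp (2 * Λ * ((c - a) / N ^ (k + 1))) * r := by
  obtain ⟨φ, hφ, hle⟩ := h
  refine FIF.matrixSpectralRadius_le
    (scalingPattern_nonneg_of_mem_image hN hac (fun t ht => (hS.pos t ht).le) hs)
    (hφ.sample_pos hN hac) (by positivity) ((vecMul_sample_le hN hac hS hs hφ).trans ?_)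
  rw [mul_smul]
  exact smul_le_smul_of_nonneg_left
    (fun j => hle _ (leftPt_mem_Icc hN hac j.2.le)) (Real.exp_pos _).le

lemma IsSubeigenvalue.le_matrixSpectralRadius (h : IsSubeigenvalue N a c S Λ r) (hN : 0 < N)
    (hac : a ≤ c) (hr : 0 ≤ r) (hS : LogLipOn Λ (Set.Icc a c) S)
    (hs : ∀ i < N, ∀ j < N ^ (k + 1), s i j ∈ S '' subSubInterval N a c (k + 1) i j) :
    r ≤ Real.exp (2 * Λ * ((c - a) / N ^ (k + 1))) *
      matrixSpectralRadius (scalingPattern N (k + 1) s) := by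
  obtain ⟨φ, hφ, hle⟩ := h
  rw [← inv_mul_le_iff₀ (Real.exp_pos _)]
  have : Nonempty (Fin (N ^ (k + 1))) := ⟨0, by positivity⟩
  refine FIF.le_matrixSpectralRadius
    (scalingPattern_nonneg_of_mem_image hN hac (fun t ht => (hS.pos t ht).le) hs)
    (Pi.lt_def.2 ⟨fun j => (hφ.sample_pos hN hac j).le, Classical.arbitrary _,
      hφ.sample_pos hN hac _⟩) (by positivity) ?_
  rw [mul_smul, inv_smul_le_iff_of_pos (Real.exp_pos _)]
  exact le_trans (fun j => hle _ (leftPt_mem_Icc hN hac j.2.le))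
    (sample_transferOp_le hN hac hS hs hφ)

lemma tendsto_exp_const_div_pow (hN : 2 ≤ N) (C : ℝ) :
    Tendsto (fun k : ℕ => Real.exp (C / (N : ℝ) ^ k)) atTop (𝓝 1) := by
  have hpow : Tendsto (fun k : ℕ => (N : ℝ) ^ k) atTop atTop :=
    tendsto_pow_atTop_atTop_of_one_lt (by exact_mod_cast hN)
  simpa [Function.comp_def] using (Real.continuous_exp.tendsto 0).comp (hpow.const_div_atTop C)

lemma tendsto_exp_mul (hN : 2 ≤ N) (C r : ℝ) :
    Tendsto (fun k : ℕ => Real.exp (2 * Λ * (C / (N : ℝ) ^ (k + 1))) * r) atTop (𝓝 r) := by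
  have h := ((tendsto_exp_const_div_pow hN (2 * Λ * C)).comp (tendsto_add_atTop_nat 1)).mul_const r
  simpa [mul_div_assoc] using h

theorem IsLeadingEigenvalue.tendsto_matrixSpectralRadius (h : IsLeadingEigenvalue N a c S Λ ρ)
    (hN : 2 ≤ N) (hac : a ≤ c) (hS : LogLipOn Λ (Set.Icc a c) S) {s : ℕ → ℕ → ℕ → ℝ}
    (hs : ∀ k, ∀ i < N, ∀ j < N ^ k, s k i j ∈ S '' subSubInterval N a c k i j) :
    Tendsto (fun k => matrixSpectralRadius (scalingPattern N k (s k))) atTop (𝓝 ρ) := by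
  have hN0 : 0 < N := by omega
  rw [← tendsto_add_atTop_iff_nat 1, tendsto_order]
  refine ⟨fun r hr => ?_, fun r hr => ?_⟩
  · obtain ⟨r', hr', hr'ρ⟩ := exists_between (max_lt h.pos hr)
    have hpos : 0 < r' := (le_max_left 0 r).trans_lt hr'
    filter_upwards [(tendsto_exp_mul (Λ := Λ) hN (c - a) (max 0 r)).eventually_lt_const hr']
      with k hk
    have hle := (h.isSubeigenvalue r' hpos hr'ρ).le_matrixSpectralRadius hN0 hac hpos.le hS
      (hs (k + 1))
    exact (le_max_right 0 r).trans_lt (lt_of_mul_lt_mul_left (hk.trans_le hle) (Real.exp_pos _).le)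
  · obtain ⟨r', hρr', hr'⟩ := exists_between hr
    filter_upwards [(tendsto_exp_mul (Λ := Λ) hN (c - a) r').eventually_lt_const hr'] with k hk
    exact ((h.isSupereigenvalue r' hρr').matrixSpectralRadius_le hN0 hac
      (h.pos.trans hρr').le hS (hs (k + 1))).trans_lt hk

lemma image_abs_subSubInterval (hN : 0 < N) (hac : a ≤ c) (hS : ∀ t ∈ Set.Icc a c, 0 ≤ S t)
    {i j : ℕ} (hi : i < N) (hj : j < N ^ k) :
    (fun t => |S t|) '' subSubInterval N a c k i j = S '' subSubInterval N a c k i j := by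
  rw [subSubInterval_eq_subInterval hN]
  exact Set.image_congr fun t ht =>
    abs_of_nonneg (hS t (subInterval_subset_Icc hN hac (mul_pow_add_lt_pow_succ hi hj) ht))

lemma isCompact_image_subSubInterval (hN : 0 < N) (hac : a ≤ c)
    (hS : ContinuousOn S (Set.Icc a c)) {i j : ℕ} (hi : i < N) (hj : j < N ^ k) :
    IsCompact (S '' subSubInterval N a c k i j) := by
  rw [subSubInterval_eq_subInterval hN]
  exact isCompact_subInterval.image_of_continuousOn
    (hS.mono (subInterval_subset_Icc hN hac (mul_pow_add_lt_pow_succ hi hj)))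

lemma sUpper_mem_image (hN : 0 < N) (hac : a ≤ c) (hc : ContinuousOn S (Set.Icc a c))
    (hS : ∀ t ∈ Set.Icc a c, 0 ≤ S t) {i j : ℕ} (hi : i < N) (hj : j < N ^ k) :
    sUpper N a c S k i j ∈ S '' subSubInterval N a c k i j := by
  rw [sUpper, image_abs_subSubInterval hN hac hS hi hj]
  exact (isCompact_image_subSubInterval hN hac hc hi hj).sSup_mem
    (Set.Nonempty.image _ ⟨_, branch_leftPt_mem_subSubInterval hN hac⟩)

lemma sLower_mem_image (hN : 0 < N) (hac : a ≤ c) (hc : ContinuousOn S (Set.Icc a c))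
    (hS : ∀ t ∈ Set.Icc a c, 0 ≤ S t) {i j : ℕ} (hi : i < N) (hj : j < N ^ k) :
    sLower N a c S k i j ∈ S '' subSubInterval N a c k i j := by
  rw [sLower, image_abs_subSubInterval hN hac hS hi hj]
  exact (isCompact_image_subSubInterval hN hac hc hi hj).sInf_mem
    (Set.Nonempty.image _ ⟨_, branch_leftPt_mem_subSubInterval hN hac⟩)

end ScalingMatrix

/-! ### Oscillation of approximately self-affine functions -/

section Oscillation

variable {f g : ℝ → ℝ} {U : Set ℝ} {ε : ℝ}

lemma oscillation_nonneg : 0 ≤ oscillation f U := Metric.diam_nonneg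

lemma abs_sub_le_oscillation (hf : Bornology.IsBounded (f '' U)) {s t : ℝ} (hs : s ∈ U)
    (ht : t ∈ U) : |f s - f t| ≤ oscillation f U :=
  Metric.dist_le_diam_of_mem hf (Set.mem_image_of_mem f hs) (Set.mem_image_of_mem f ht)

lemma oscillation_le (hε : 0 ≤ ε) (h : ∀ s ∈ U, ∀ t ∈ U, |f s - f t| ≤ ε) :
    oscillation f U ≤ ε :=
  Metric.diam_le_of_forall_dist_le hε
    (Set.forall_mem_image.2 fun s hs => Set.forall_mem_image.2 (h s hs))

lemma oscillation_le_add (hf : Bornology.IsBounded (f '' U)) (hε : 0 ≤ ε)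
    (h : ∀ s ∈ U, ∀ t ∈ U, |g s - g t| ≤ |f s - f t| + ε) :
    oscillation g U ≤ oscillation f U + ε :=
  oscillation_le (add_nonneg oscillation_nonneg hε) fun s hs t ht =>
    (h s hs t ht).trans (add_le_add_left (abs_sub_le_oscillation hf hs ht) ε)

lemma abs_oscillation_sub_le (hf : Bornology.IsBounded (f '' U)) (hg : Bornology.IsBounded (g '' U))
    (hε : 0 ≤ ε) (h : ∀ s ∈ U, ∀ t ∈ U, |(g s - g t) - (f s - f t)| ≤ ε) :
    |oscillation g U - oscillation f U| ≤ ε := by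
  rw [abs_sub_le_iff, sub_le_iff_le_add', sub_le_iff_le_add']
  refine ⟨oscillation_le_add hf hε fun s hs t ht => ?_,
    oscillation_le_add hg hε fun s hs t ht => ?_⟩
  · linarith [h s hs t ht, abs_sub_abs_le_abs_sub (g s - g t) (f s - f t)]
  · linarith [h s hs t ht, abs_sub_abs_le_abs_sub (f s - f t) (g s - g t),
      abs_sub_comm (f s - f t) (g s - g t)]

section Scaling

open scoped Pointwise

lemma image_const_mul (σ : ℝ) : (fun t => σ * f t) '' U = σ • f '' U :=
  (Set.image_image (σ * ·) f U).symm

lemma isBounded_image_const_mul (hf : Bornology.IsBounded (f '' U)) (σ : ℝ) :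
    Bornology.IsBounded ((fun t => σ * f t) '' U) :=
  image_const_mul σ ▸ hf.smul₀ σ

lemma oscillation_const_mul (σ : ℝ) :
    oscillation (fun t => σ * f t) U = |σ| * oscillation f U := by
  rw [oscillation, image_const_mul, diam_smul₀, Real.norm_eq_abs, oscillation]

end Scaling

lemma oscillation_comp (β : ℝ → ℝ) : oscillation (f ∘ β) U = oscillation f (β '' U) :=
  congrArg Metric.diam (Set.image_comp f β U)

lemma oscillation_Icc_leftPt_le_sum {N : ℕ} {a c : ℝ} (hac : a ≤ c) (f : ℝ → ℝ) (k q n : ℕ) :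
    oscillation f (Set.Icc (leftPt N a c k q) (leftPt N a c k (q + n))) ≤
      ∑ m ∈ Finset.range n, oscillation f (subInterval N a c k (q + m)) := by
  induction n with
  | zero => simp [oscillation]
  | succ n ih =>
    have hleft := leftPt_mono (N := N) (k := k) hac (Nat.le_add_right q n)
    have hright := leftPt_mono (N := N) (k := k) hac (Nat.le_succ (q + n))
    rw [Finset.sum_range_succ, ← add_assoc, ← Set.Icc_union_Icc_eq_Icc hleft hright, oscillation,
      Set.image_union]
    refine (Metric.diam_union' ⟨f (leftPt N a c k (q + n)), ?_, ?_⟩).trans (add_le_add ih ?_)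
    · exact Set.mem_image_of_mem f (Set.right_mem_Icc.2 hleft)
    · exact Set.mem_image_of_mem f (Set.left_mem_Icc.2 hright)
    · rw [subInterval_eq_Icc, oscillation]

lemma monotone_totalOsc {N : ℕ} {a c : ℝ} (hN : 0 < N) (hac : a ≤ c) (f : ℝ → ℝ) :
    Monotone fun p => totalOsc N p f a c := by
  refine monotone_nat_of_le_succ fun p => ?_
  rw [totalOsc, totalOsc, pow_succ, sum_range_mul]
  refine Finset.sum_le_sum fun j _ => ?_
  rw [subInterval_eq_Icc, ← leftPt_mul hN, ← leftPt_mul (j := j + 1) hN, Nat.succ_mul]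
  exact oscillation_Icc_leftPt_le_sum hac f (p + 1) (j * N) N

lemma totalOsc_nonneg {N p : ℕ} {a c : ℝ} : 0 ≤ totalOsc N p f a c :=
  Finset.sum_nonneg fun _ _ => oscillation_nonneg

end Oscillation

/-- Increments of `f` over a branch are those of `f` scaled by `S`, up to a first-order error. -/
def ApproxSelfAffine (N : ℕ) (a c : ℝ) (S f : ℝ → ℝ) (C : NNReal) : Prop :=
  ∀ i < N, ∀ u ∈ Set.Icc a c, ∀ s ∈ Set.Icc a c, ∀ t ∈ Set.Icc a c,
    |(f (branch N a c i s) - f (branch N a c i t)) - S (branch N a c i u) * (f s - f t)| ≤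
      C * (dist s u + dist t u)

/-- The total oscillation weighted by the values of `φ` at left end points. -/
def weightedOsc (N : ℕ) (a c : ℝ) (φ f : ℝ → ℝ) (k : ℕ) : ℝ :=
  ∑ j ∈ Finset.range (N ^ k), φ (leftPt N a c k j) * oscillation f (subInterval N a c k j)

section WeightedOscillation

variable {N k : ℕ} {a c r B E : ℝ} {S φ ψ f : ℝ → ℝ} {Λ C : NNReal}

lemma subInterval_succ_eq_image_branch (hN : 0 < N) (i j : ℕ) :
    subInterval N a c (k + 1) (i * N ^ k + j) = branch N a c i '' subInterval N a c k j := by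
  have hN' : (0 : ℝ) < (N : ℝ)⁻¹ := inv_pos.2 (by exact_mod_cast hN)
  have haffine : branch N a c i = fun t => (N : ℝ)⁻¹ * t + (a + i / N * (c - a) - a / N) := by
    ext t
    unfold branch
    ring
  rw [subInterval_eq_Icc, subInterval_eq_Icc, add_assoc, ← branch_leftPt hN, ← branch_leftPt hN,
    haffine, Set.image_affine_Icc' hN']

lemma ApproxSelfAffine.abs_oscillation_image_branch_sub_le (hfS : ApproxSelfAffine N a c S f C)
    (hf : Bornology.IsBounded (f '' Set.Icc a c)) {U : Set ℝ} (hU : U ⊆ Set.Icc a c) {u d : ℝ}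
    (hu : u ∈ U) (hd : ∀ t ∈ U, dist t u ≤ d) {i : ℕ} (hi : i < N)
    (hS : 0 ≤ S (branch N a c i u)) :
    |oscillation f (branch N a c i '' U) - S (branch N a c i u) * oscillation f U| ≤
      C * (2 * d) := by
  have hd0 : 0 ≤ d := dist_nonneg.trans (hd u hu)
  have hbranch : branch N a c i '' U ⊆ Set.Icc a c :=
    Set.image_subset_iff.2 fun t ht => branch_mem_Icc hi (hU ht)
  have hscaled := oscillation_const_mul (f := f) (U := U) (S (branch N a c i u))
  rw [abs_of_nonneg hS] at hscaled
  rw [← oscillation_comp, ← hscaled]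
  refine abs_oscillation_sub_le (isBounded_image_const_mul (hf.subset (Set.image_mono hU)) _) ?_
    (by positivity) fun s hs t ht => ?_
  · rw [Set.image_comp]
    exact hf.subset (Set.image_mono hbranch)
  · rw [← mul_sub]
    refine (hfS i hi u (hU hu) s (hU hs) t (hU ht)).trans ?_
    rw [two_mul]
    exact mul_le_mul_of_nonneg_left (add_le_add (hd s hs) (hd t ht)) C.2

lemma weightedOsc_succ (hN : 0 < N) :
    weightedOsc N a c φ f (k + 1) = ∑ i ∈ Finset.range N, ∑ j ∈ Finset.range (N ^ k),
      φ (branch N a c i (leftPt N a c k j)) *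
        oscillation f (branch N a c i '' subInterval N a c k j) := by
  simp only [weightedOsc, pow_succ', sum_range_mul, branch_leftPt hN,
    subInterval_succ_eq_image_branch hN]

lemma weightedOsc_transferOp :
    weightedOsc N a c (transferOp N a c S φ) f k =
      ∑ i ∈ Finset.range N, ∑ j ∈ Finset.range (N ^ k), φ (branch N a c i (leftPt N a c k j)) *
        (S (branch N a c i (leftPt N a c k j)) * oscillation f (subInterval N a c k j)) := by
  simp only [weightedOsc, transferOp, Finset.sum_mul]
  rw [Finset.sum_comm]
  exact Finset.sum_congr rfl fun _ _ => Finset.sum_congr rfl fun _ _ => by ring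

lemma ApproxSelfAffine.dist_weightedOsc_succ_le (hfS : ApproxSelfAffine N a c S f C) (hN : 0 < N)
    (hac : a ≤ c) (hS : ∀ t ∈ Set.Icc a c, 0 ≤ S t) (hf : Bornology.IsBounded (f '' Set.Icc a c))
    (hφ : ∀ t ∈ Set.Icc a c, 0 ≤ φ t) (hφB : ∀ t ∈ Set.Icc a c, φ t ≤ B) (k : ℕ) :
    dist (weightedOsc N a c φ f (k + 1)) (weightedOsc N a c (transferOp N a c S φ) f k) ≤
      N * (B * (C * (2 * (c - a)))) := by
  have hterm : ∀ i ∈ Finset.range N, ∀ j ∈ Finset.range (N ^ k),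
      dist (φ (branch N a c i (leftPt N a c k j)) *
          oscillation f (branch N a c i '' subInterval N a c k j))
        (φ (branch N a c i (leftPt N a c k j)) *
          (S (branch N a c i (leftPt N a c k j)) * oscillation f (subInterval N a c k j))) ≤
        B * (C * (2 * ((c - a) / N ^ k))) := fun i hi j hj => by
    have hi' := Finset.mem_range.1 hi
    have hj' := Finset.mem_range.1 hj
    have hmem := branch_mem_Icc hi' (leftPt_mem_Icc hN hac hj'.le)
    have hleft := leftPt_mem_subInterval (N := N) (k := k) (j := j) hac
    rw [Real.dist_eq, ← mul_sub, abs_mul, abs_of_nonneg (hφ _ hmem)]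
    exact mul_le_mul (hφB _ hmem)
      (hfS.abs_oscillation_image_branch_sub_le hf (subInterval_subset_Icc hN hac hj') hleft
        (fun t ht => dist_le_of_mem_subInterval ht hleft) hi' (hS _ hmem))
      (abs_nonneg _) ((hφ _ hmem).trans (hφB _ hmem))
  rw [weightedOsc_succ hN, weightedOsc_transferOp]
  refine (dist_sum_sum_le_of_le _ fun i hi => dist_sum_sum_le_of_le _ (hterm i hi)).trans_eq ?_
  simp only [Finset.sum_const, Finset.card_range, nsmul_eq_mul, Nat.cast_pow]
  field_simp

lemma weightedOsc_mono (hN : 0 < N) (hac : a ≤ c) (h : ∀ t ∈ Set.Icc a c, φ t ≤ ψ t) (k : ℕ) :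
    weightedOsc N a c φ f k ≤ weightedOsc N a c ψ f k :=
  Finset.sum_le_sum fun _ hj => mul_le_mul_of_nonneg_right
    (h _ (leftPt_mem_Icc hN hac (Finset.mem_range.1 hj).le)) oscillation_nonneg

lemma weightedOsc_const_mul : weightedOsc N a c (fun t => r * φ t) f k =
    r * weightedOsc N a c φ f k := by
  simp only [weightedOsc, Finset.mul_sum, mul_assoc]

lemma weightedOsc_const : weightedOsc N a c (fun _ => r) f k = r * totalOsc N k f a c := by
  rw [weightedOsc, totalOsc, Finset.mul_sum]

lemma le_pow_mul_of_succ_le {x : ℕ → ℝ} (hr : 1 < r) (h : ∀ p, x (p + 1) ≤ r * x p + E) (p : ℕ) :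
    x p + E / (r - 1) ≤ r ^ p * (x 0 + E / (r - 1)) := by
  have hr' : r - 1 ≠ 0 := (sub_pos.2 hr).ne'
  have hfix : E + E / (r - 1) = r * (E / (r - 1)) := by field_simp; ring
  exact le_geom (u := fun p => x p + E / (r - 1)) (zero_le_one.trans hr.le) p fun k _ => by
    linarith [h k]

lemma exists_pow_mul_le_of_le_succ {x : ℕ → ℝ} (hr : 1 < r) (hE : 0 ≤ E)
    (h : ∀ p, r * x p ≤ x (p + 1) + E) (hx : Tendsto x atTop atTop) :
    ∃ κ > 0, ∀ᶠ p in atTop, κ * r ^ p ≤ x p := by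
  have hr0 : 0 < r := one_pos.trans hr
  have hfix : E + E / (r - 1) = r * (E / (r - 1)) := by
    have : r - 1 ≠ 0 := (sub_pos.2 hr).ne'
    field_simp
    ring
  obtain ⟨q, hq⟩ := (hx.eventually_ge_atTop (E / (r - 1) + 1)).exists
  have hgrowth (n : ℕ) : r ^ n * 1 ≤ x (q + n) - E / (r - 1) :=
    (mul_le_mul_of_nonneg_left (le_sub_iff_add_le'.2 hq) (pow_pos hr0 n).le).trans
      (geom_le (u := fun n => x (q + n) - E / (r - 1)) hr0.le n fun k _ => by
        have := h (q + k)
        rw [add_assoc] at this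
        linarith)
  refine ⟨(r ^ q)⁻¹, by positivity, ?_⟩
  filter_upwards [eventually_ge_atTop q] with p hp
  obtain ⟨n, rfl⟩ := Nat.exists_eq_add_of_le hp
  rw [pow_add, inv_mul_cancel_left₀ (by positivity)]
  linarith [hgrowth n, div_nonneg hE (sub_nonneg.2 hr.le)]

lemma IsSupereigenvalue.exists_totalOsc_le (h : IsSupereigenvalue N a c S Λ r)
    (hfS : ApproxSelfAffine N a c S f C) (hN : 0 < N) (hac : a ≤ c)
    (hS : ∀ t ∈ Set.Icc a c, 0 ≤ S t) (hf : Bornology.IsBounded (f '' Set.Icc a c)) (hr : 1 < r) :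
    ∃ D, ∀ p, totalOsc N p f a c ≤ D * r ^ p := by
  obtain ⟨φ, hφ, hle⟩ := h
  obtain ⟨m, M, hm, hbounds⟩ := hφ.exists_bounds (Metric.isBounded_Icc a c)
  have hM : 0 ≤ M := hm.le.trans ((hbounds a ⟨le_rfl, hac⟩).1.trans (hbounds a ⟨le_rfl, hac⟩).2)
  set E := N * (M * (C * (2 * (c - a))))
  have hE : 0 ≤ E := by
    have := sub_nonneg.2 hac
    positivity
  have hrec (p : ℕ) : weightedOsc N a c φ f (p + 1) ≤ r * weightedOsc N a c φ f p + E := by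
    have hstep := hfS.dist_weightedOsc_succ_le hN hac hS hf (fun t ht => (hφ.pos t ht).le)
      (fun t ht => (hbounds t ht).2) p
    have heigen := weightedOsc_mono (f := f) hN hac hle p
    rw [weightedOsc_const_mul] at heigen
    linarith [(abs_le.1 hstep).2]
  refine ⟨(weightedOsc N a c φ f 0 + E / (r - 1)) / m, fun p => ?_⟩
  have hlower := weightedOsc_mono (f := f) hN hac (fun t ht => (hbounds t ht).1) p
  rw [weightedOsc_const] at hlower
  rw [div_mul_eq_mul_div, le_div_iff₀' hm, mul_comm _ (r ^ p)]
  linarith [le_pow_mul_of_succ_le hr hrec p, div_nonneg hE (sub_nonneg.2 hr.le)]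

lemma IsSubeigenvalue.exists_le_totalOsc (h : IsSubeigenvalue N a c S Λ r)
    (hfS : ApproxSelfAffine N a c S f C) (hN : 0 < N) (hac : a ≤ c)
    (hS : ∀ t ∈ Set.Icc a c, 0 ≤ S t) (hf : Bornology.IsBounded (f '' Set.Icc a c)) (hr : 1 < r)
    (htop : Tendsto (fun p => totalOsc N p f a c) atTop atTop) :
    ∃ κ > 0, ∀ᶠ p in atTop, κ * r ^ p ≤ totalOsc N p f a c := by
  obtain ⟨φ, hφ, hle⟩ := h
  obtain ⟨m, M, hm, hbounds⟩ := hφ.exists_bounds (Metric.isBounded_Icc a c)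
  have hM : 0 < M := hm.trans_le ((hbounds a ⟨le_rfl, hac⟩).1.trans (hbounds a ⟨le_rfl, hac⟩).2)
  set E := N * (M * (C * (2 * (c - a))))
  have hE : 0 ≤ E := by
    have := sub_nonneg.2 hac
    positivity
  have hrec (p : ℕ) : r * weightedOsc N a c φ f p ≤ weightedOsc N a c φ f (p + 1) + E := by
    have hstep := hfS.dist_weightedOsc_succ_le hN hac hS hf (fun t ht => (hφ.pos t ht).le)
      (fun t ht => (hbounds t ht).2) p
    have heigen := weightedOsc_mono (f := f) hN hac hle p
    rw [weightedOsc_const_mul] at heigen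
    linarith [(abs_le.1 hstep).1]
  have hlower (p : ℕ) : m * totalOsc N p f a c ≤ weightedOsc N a c φ f p :=
    weightedOsc_const.symm.trans_le (weightedOsc_mono hN hac (fun t ht => (hbounds t ht).1) p)
  obtain ⟨κ, hκ, hev⟩ := exists_pow_mul_le_of_le_succ hr hE hrec
    (tendsto_atTop_mono hlower (htop.const_mul_atTop hm))
  refine ⟨κ / M, div_pos hκ hM, ?_⟩
  filter_upwards [hev] with p hp
  have hupper := weightedOsc_mono (f := f) hN hac (fun t ht => (hbounds t ht).2) p
  rw [weightedOsc_const] at hupper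
  rw [div_mul_eq_mul_div, div_le_iff₀' hM]
  exact hp.trans hupper

end WeightedOscillation

/-! ### Counting boxes -/

/-- The indices of the `ε`-coordinate squares meeting `E`. -/
def boxIndices (E : Set (ℝ × ℝ)) (ε : ℝ) : Set (ℤ × ℤ) :=
  {k | (coordSquare ε k ∩ E).Nonempty}

/-- A finite set containing the indices `k` of all the intervals `[kε, (k + 1)ε]` that meet
`[α, β]`. -/
def gridIndices (ε α β : ℝ) : Finset ℤ :=
  Finset.Icc ⌈α / ε - 1⌉ ⌊β / ε⌋

section Boxes

variable {ε α β γ δ : ℝ} {E : Set (ℝ × ℝ)}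

lemma mem_gridIndices (hε : 0 < ε) {t : ℝ} (ht : t ∈ Set.Icc α β) {k : ℤ}
    (hk : t ∈ Set.Icc (k * ε) ((k + 1) * ε)) : k ∈ gridIndices ε α β := by
  rw [gridIndices, Finset.mem_Icc, Int.ceil_le, Int.le_floor, le_div_iff₀ hε, sub_le_iff_le_add,
    div_le_iff₀ hε]
  exact ⟨ht.1.trans hk.2, hk.1.trans ht.2⟩

lemma card_gridIndices_le (hε : 0 < ε) (hαβ : α ≤ β) :
    ((gridIndices ε α β).card : ℝ) ≤ (β - α) / ε + 2 := by
  have hdiv : α / ε ≤ β / ε := div_le_div_of_nonneg_right hαβ hε.le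
  have hle : ⌈α / ε - 1⌉ ≤ ⌊β / ε⌋ + 1 := by
    rw [Int.ceil_le]
    push_cast
    linarith [Int.lt_floor_add_one (β / ε)]
  have hcard : ((gridIndices ε α β).card : ℝ) = ⌊β / ε⌋ + 1 - ⌈α / ε - 1⌉ := by
    exact_mod_cast Int.card_Icc_of_le _ _ hle
  rw [hcard, sub_div]
  linarith [Int.floor_le (β / ε), Int.le_ceil (α / ε - 1)]

lemma mem_Icc_floor (hε : 0 < ε) (t : ℝ) :
    t ∈ Set.Icc ((⌊t / ε⌋ : ℝ) * ε) ((⌊t / ε⌋ + 1) * ε) :=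
  ⟨(le_div_iff₀ hε).1 (Int.floor_le _), (div_le_iff₀ hε).1 (Int.lt_floor_add_one _).le⟩

lemma nonempty_boxIndices (hε : 0 < ε) (hE : E.Nonempty) : (boxIndices E ε).Nonempty :=
  let ⟨p, hp⟩ := hE
  ⟨(⌊p.1 / ε⌋, ⌊p.2 / ε⌋), p, ⟨mem_Icc_floor hε p.1, mem_Icc_floor hε p.2⟩, hp⟩

lemma boxIndices_subset_gridIndices (hε : 0 < ε) (hE : E ⊆ Set.Icc α β ×ˢ Set.Icc γ δ) :
    boxIndices E ε ⊆ ↑(gridIndices ε α β ×ˢ gridIndices ε γ δ) := by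
  rintro k ⟨p, hpk, hpE⟩
  exact Finset.mem_product.2
    ⟨mem_gridIndices hε (hE hpE).1 hpk.1, mem_gridIndices hε (hE hpE).2 hpk.2⟩

lemma finite_boxIndices (hε : 0 < ε) (hE : Bornology.IsBounded E) : (boxIndices E ε).Finite := by
  obtain ⟨R, hR⟩ := hE.subset_closedBall 0
  rw [← closedBall_prod_same, Real.closedBall_eq_Icc, Real.closedBall_eq_Icc] at hR
  exact (Finset.finite_toSet _).subset (boxIndices_subset_gridIndices hε hR)

lemma boxCount_le_of_subset (hε : 0 < ε) (hαβ : α ≤ β) (hγδ : γ ≤ δ)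
    (hE : E ⊆ Set.Icc α β ×ˢ Set.Icc γ δ) :
    (boxCount E ε : ℝ) ≤ ((β - α) / ε + 2) * ((δ - γ) / ε + 2) := by
  have hcard : boxCount E ε ≤ (gridIndices ε α β ×ˢ gridIndices ε γ δ).card :=
    (Set.ncard_le_ncard (boxIndices_subset_gridIndices hε hE) (Finset.finite_toSet _)).trans_eq
      (Set.ncard_coe_finset _)
  rw [Finset.card_product] at hcard
  calc (boxCount E ε : ℝ) ≤ (gridIndices ε α β).card * (gridIndices ε γ δ).card := by
        exact_mod_cast hcard
    _ ≤ ((β - α) / ε + 2) * ((δ - γ) / ε + 2) := by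
        have := card_gridIndices_le hε hαβ
        gcongr
        exact card_gridIndices_le hε hγδ

section Families

variable {ι : Type*} (s : Finset ι) (A : ι → Set (ℝ × ℝ))

lemma boxIndices_biUnion : boxIndices (⋃ j ∈ s, A j) ε = ⋃ j ∈ s, boxIndices (A j) ε := by
  ext k
  simp only [boxIndices, Set.mem_ofPred_eq, Set.inter_iUnion, Set.nonempty_iUnion, Set.mem_iUnion]

lemma boxCount_biUnion_le : boxCount (⋃ j ∈ s, A j) ε ≤ ∑ j ∈ s, boxCount (A j) ε :=
  (congrArg Set.ncard (boxIndices_biUnion s A)).trans_le (s.set_ncard_biUnion_le _)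

open scoped Classical in
lemma sum_boxCount_le_mul (hfin : (boxIndices (⋃ j ∈ s, A j) ε).Finite) {m : ℕ}
    (hm : ∀ k, (s.filter fun j => k ∈ boxIndices (A j) ε).card ≤ m) :
    ∑ j ∈ s, boxCount (A j) ε ≤ m * boxCount (⋃ j ∈ s, A j) ε := by
  have hcolumn : ∀ j ∈ s, boxCount (A j) ε =
      (hfin.toFinset.bipartiteAbove (fun j k => k ∈ boxIndices (A j) ε) j).card := fun j hj => by
    rw [← Set.ncard_coe_finset, Finset.coe_bipartiteAbove]
    refine congrArg Set.ncard (Set.ext fun k => ?_)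
    simp only [Set.Finite.mem_toFinset, boxIndices_biUnion, Set.mem_iUnion, Set.mem_ofPred_eq]
    exact ⟨fun hk => ⟨⟨j, hj, hk⟩, hk⟩, fun hk => hk.2⟩
  rw [Finset.sum_congr rfl hcolumn, Finset.sum_card_bipartiteAbove_eq_sum_card_bipartiteBelow]
  refine (Finset.sum_le_card_nsmul _ _ m fun k _ => hm k).trans_eq ?_
  rw [smul_eq_mul, mul_comm, ← Set.ncard_eq_toFinset_card _ hfin]
  rfl

end Families

section Graph

variable {f : ℝ → ℝ} {U : Set ℝ}

lemma isBounded_graphOn (hU : Bornology.IsBounded U) (hf : Bornology.IsBounded (f '' U)) :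
    Bornology.IsBounded (U.graphOn f) :=
  (hU.prod hf).subset (by rintro _ ⟨t, ht, rfl⟩; exact ⟨ht, Set.mem_image_of_mem f ht⟩)

lemma boxCount_graphOn_le (hε : 0 < ε) (hU : U ⊆ Set.Icc α β) (hne : U.Nonempty)
    (hwidth : β - α ≤ ε) (hf : Bornology.IsBounded (f '' U)) :
    (boxCount (U.graphOn f) ε : ℝ) ≤ 6 * (oscillation f U / ε + 1) := by
  obtain ⟨s, hs⟩ := hne
  set o := oscillation f U
  have ho0 : 0 ≤ o := oscillation_nonneg
  have hsub : U.graphOn f ⊆ Set.Icc α β ×ˢ Set.Icc (f s - o) (f s + o) := by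
    rintro _ ⟨t, ht, rfl⟩
    have hts := abs_le.1 (abs_sub_le_oscillation hf ht hs)
    exact ⟨hU ht, by linarith [hts.1], by linarith [hts.2]⟩
  calc (boxCount (U.graphOn f) ε : ℝ)
      ≤ ((β - α) / ε + 2) * ((f s + o - (f s - o)) / ε + 2) :=
        boxCount_le_of_subset hε ((hU hs).1.trans (hU hs).2) (by linarith) hsub
    _ ≤ (1 + 2) * ((f s + o - (f s - o)) / ε + 2) := by
        have : (f s + o - (f s - o)) / ε = 2 * o / ε := by ring
        rw [this]
        gcongr
        exact (div_le_one hε).2 hwidth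
    _ = 6 * (o / ε + 1) := by ring

lemma Icc_floor_subset_image_snd (hε : 0 < ε) (hU : IsPreconnected U) (hf : ContinuousOn f U)
    {s t : ℝ} (hs : s ∈ U) (ht : t ∈ U) (hst : f s ≤ f t) :
    Set.Icc ⌊f s / ε⌋ ⌊f t / ε⌋ ⊆ Prod.snd '' boxIndices (U.graphOn f) ε := by
  rintro q ⟨hsq, hqt⟩
  have hq : (q : ℝ) * ε ≤ f t := (le_div_iff₀ hε).1 (Int.le_floor.1 hqt)
  have hq' : f s ≤ (q + 1) * ε := by
    rw [← div_le_iff₀ hε]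
    exact (Int.lt_floor_add_one _).le.trans (by exact_mod_cast Int.add_le_add_right hsq 1)
  obtain ⟨v, hv, hvq⟩ := hU.intermediate_value hs ht hf
    (show max (f s) (q * ε) ∈ Set.Icc (f s) (f t) from ⟨le_max_left _ _, max_le hst hq⟩)
  refine ⟨(⌊v / ε⌋, q), ⟨(v, f v), ⟨mem_Icc_floor hε v, ?_⟩, v, hv, rfl⟩, rfl⟩
  rw [hvq]
  exact ⟨le_max_right _ _, max_le hq' (by linarith)⟩

lemma abs_sub_le_mul_boxCount (hε : 0 < ε) (hU : IsPreconnected U) (hf : ContinuousOn f U)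
    (hfin : (boxIndices (U.graphOn f) ε).Finite) {s t : ℝ} (hs : s ∈ U) (ht : t ∈ U) :
    |f s - f t| ≤ ε * boxCount (U.graphOn f) ε := by
  wlog hst : f s ≤ f t generalizing s t
  · rw [abs_sub_comm]
    exact this ht hs (le_of_not_ge hst)
  have hcard : (Finset.Icc ⌊f s / ε⌋ ⌊f t / ε⌋).card ≤ boxCount (U.graphOn f) ε := by
    rw [← Set.ncard_coe_finset, Finset.coe_Icc]
    exact (Set.ncard_le_ncard (Icc_floor_subset_image_snd hε hU hf hs ht hst)
      (hfin.image _)).trans (Set.ncard_image_le hfin)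
  have hfloor : ⌊f s / ε⌋ ≤ ⌊f t / ε⌋ := Int.floor_le_floor (by gcongr)
  have hle : (⌊f t / ε⌋ + 1 - ⌊f s / ε⌋ : ℝ) ≤ boxCount (U.graphOn f) ε := by
    have hcast := Int.card_Icc_of_le ⌊f s / ε⌋ ⌊f t / ε⌋ (by omega)
    exact_mod_cast hcast.symm.trans_le (by exact_mod_cast hcard)
  rw [abs_sub_comm, abs_of_nonneg (sub_nonneg.2 hst), ← div_le_iff₀' hε, sub_div]
  linarith [Int.floor_le (f s / ε), Int.lt_floor_add_one (f t / ε)]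

lemma oscillation_div_le_boxCount (hε : 0 < ε) (hU : IsPreconnected U) (hf : ContinuousOn f U)
    (hfin : (boxIndices (U.graphOn f) ε).Finite) :
    oscillation f U / ε ≤ boxCount (U.graphOn f) ε :=
  (div_le_iff₀' hε).2 (oscillation_le (by positivity) fun _ hs _ ht =>
    abs_sub_le_mul_boxCount hε hU hf hfin hs ht)

lemma one_le_boxCount (hε : 0 < ε) (hE : E.Nonempty) (hfin : (boxIndices E ε).Finite) :
    1 ≤ boxCount E ε :=
  (Set.ncard_pos hfin).2 (nonempty_boxIndices hε hE)

end Graph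

end Boxes

section GraphOverInterval

variable {N k : ℕ} {a c ε : ℝ} {f : ℝ → ℝ}

lemma exists_mem_Icc_succ {u : ℕ → ℝ} {n : ℕ} (hn : n ≠ 0) {t : ℝ} (ht : t ∈ Set.Icc (u 0) (u n)) :
    ∃ j < n, t ∈ Set.Icc (u j) (u (j + 1)) := by
  induction n with
  | zero => exact absurd rfl hn
  | succ n ih =>
    rcases le_total (u n) t with hnt | htn
    · exact ⟨n, n.lt_succ_self, hnt, ht.2⟩
    · rcases eq_or_ne n 0 with rfl | hn0
      · exact ⟨0, Nat.one_pos, ht⟩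
      · obtain ⟨j, hj, hjt⟩ := ih hn0 ⟨ht.1, htn⟩
        exact ⟨j, hj.trans n.lt_succ_self, hjt⟩

lemma biUnion_subInterval (hN : 0 < N) (hac : a ≤ c) (k : ℕ) :
    ⋃ j ∈ Finset.range (N ^ k), subInterval N a c k j = Set.Icc a c := by
  refine Set.Subset.antisymm (Set.iUnion₂_subset fun j hj =>
    subInterval_subset_Icc hN hac (Finset.mem_range.1 hj)) fun t ht => ?_
  have ht' : t ∈ Set.Icc (leftPt N a c k 0) (leftPt N a c k (N ^ k)) := by
    rwa [leftPt_zero, leftPt_pow hN]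
  obtain ⟨j, hj, htj⟩ := exists_mem_Icc_succ (u := leftPt N a c k) (pow_pos hN k).ne' ht'
  rw [← subInterval_eq_Icc] at htj
  exact Set.mem_iUnion₂.2 ⟨j, Finset.mem_range.2 hj, htj⟩

lemma graphOn_Icc_eq_biUnion (hN : 0 < N) (hac : a ≤ c) (k : ℕ) :
    (Set.Icc a c).graphOn f =
      ⋃ j ∈ Finset.range (N ^ k), (subInterval N a c k j).graphOn f := by
  rw [← biUnion_subInterval hN hac k]
  exact Set.image_iUnion₂ _ _

lemma boxCount_graphOn_Icc_le (hN : 0 < N) (hac : a ≤ c)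
    (hf : Bornology.IsBounded (f '' Set.Icc a c)) (hε : 0 < ε)
    (hk : (c - a) / (N : ℝ) ^ k ≤ ε) :
    (boxCount ((Set.Icc a c).graphOn f) ε : ℝ) ≤ 6 * (totalOsc N k f a c / ε + N ^ k) := by
  have hcolumn : ∀ j ∈ Finset.range (N ^ k), (boxCount ((subInterval N a c k j).graphOn f) ε : ℝ) ≤
      6 * (oscillation f (subInterval N a c k j) / ε + 1) := fun j hj =>
    boxCount_graphOn_le hε subInterval_eq_Icc.subset ⟨_, leftPt_mem_subInterval hac⟩
      (by rwa [leftPt_succ, add_sub_cancel_left])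
      (hf.subset (Set.image_mono (subInterval_subset_Icc hN hac (Finset.mem_range.1 hj))))
  calc (boxCount ((Set.Icc a c).graphOn f) ε : ℝ)
      ≤ ∑ j ∈ Finset.range (N ^ k), (boxCount ((subInterval N a c k j).graphOn f) ε : ℝ) := by
        rw [graphOn_Icc_eq_biUnion hN hac k]
        exact_mod_cast boxCount_biUnion_le _ _
    _ ≤ ∑ j ∈ Finset.range (N ^ k), 6 * (oscillation f (subInterval N a c k j) / ε + 1) :=
        Finset.sum_le_sum hcolumn
    _ = 6 * (totalOsc N k f a c / ε + N ^ k) := by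
        rw [← Finset.mul_sum, Finset.sum_add_distrib, ← Finset.sum_div]
        simp [totalOsc]

open scoped Classical in
lemma card_filter_mem_boxIndices_le (hε : 0 < ε) (hk : ε ≤ (c - a) / (N : ℝ) ^ k) (q : ℤ × ℤ) :
    ((Finset.range (N ^ k)).filter fun j =>
      q ∈ boxIndices ((subInterval N a c k j).graphOn f) ε).card ≤ 3 := by
  set w := (c - a) / (N : ℝ) ^ k
  have hw : 0 < w := hε.trans_le hk
  have hgrid : ∀ j : ℕ, q ∈ boxIndices ((subInterval N a c k j).graphOn f) ε →
      (j : ℤ) ∈ gridIndices w (q.1 * ε - a) ((q.1 + 1) * ε - a) := by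
    rintro j ⟨_, hq, t, ht, rfl⟩
    have hleft : leftPt N a c k j = a + j * w := by rw [leftPt]; ring
    rw [subInterval_eq_Icc, leftPt_succ, hleft] at ht
    refine mem_gridIndices hw (t := t - a) ⟨?_, ?_⟩ ⟨?_, ?_⟩
    · exact sub_le_sub_right hq.1.1 a
    · exact sub_le_sub_right hq.1.2 a
    · push_cast; linarith [ht.1]
    · push_cast; linarith [ht.2]
  refine (Finset.card_le_card_of_injOn (fun j : ℕ => (j : ℤ))
    (fun j hj => hgrid j (Finset.mem_filter.1 hj).2) Nat.cast_injective.injOn).trans ?_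
  have hcard : ((gridIndices w (q.1 * ε - a) ((q.1 + 1) * ε - a)).card : ℝ) ≤ 3 :=
    calc _ ≤ ((q.1 + 1) * ε - a - (q.1 * ε - a)) / w + 2 :=
          card_gridIndices_le hw (by linarith)
      _ = ε / w + 2 := by ring
      _ ≤ 1 + 2 := add_le_add_left ((div_le_one hw).2 hk) 2
      _ = 3 := by norm_num
  exact_mod_cast hcard

lemma sum_boxCount_subInterval_le (hN : 0 < N) (hac : a ≤ c)
    (hf : Bornology.IsBounded (f '' Set.Icc a c)) (hε : 0 < ε) (hk : ε ≤ (c - a) / (N : ℝ) ^ k) :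
    ∑ j ∈ Finset.range (N ^ k), boxCount ((subInterval N a c k j).graphOn f) ε ≤
      3 * boxCount ((Set.Icc a c).graphOn f) ε := by
  rw [graphOn_Icc_eq_biUnion hN hac k]
  refine sum_boxCount_le_mul _ _ (finite_boxIndices hε ?_) (card_filter_mem_boxIndices_le hε hk)
  rw [← graphOn_Icc_eq_biUnion hN hac k]
  exact isBounded_graphOn (Metric.isBounded_Icc a c) hf

lemma finite_boxIndices_subInterval (hN : 0 < N) (hac : a ≤ c)
    (hf : Bornology.IsBounded (f '' Set.Icc a c)) (hε : 0 < ε) {j : ℕ} (hj : j < N ^ k) :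
    (boxIndices ((subInterval N a c k j).graphOn f) ε).Finite :=
  finite_boxIndices hε (isBounded_graphOn isCompact_subInterval.isBounded
    (hf.subset (Set.image_mono (subInterval_subset_Icc hN hac hj))))

lemma pow_le_boxCount_graphOn_Icc (hN : 0 < N) (hac : a ≤ c)
    (hf : Bornology.IsBounded (f '' Set.Icc a c)) (hε : 0 < ε) (hk : ε ≤ (c - a) / (N : ℝ) ^ k) :
    (N : ℝ) ^ k ≤ 3 * boxCount ((Set.Icc a c).graphOn f) ε := by
  have hcolumns := Finset.card_nsmul_le_sum (Finset.range (N ^ k))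
    (fun j => boxCount ((subInterval N a c k j).graphOn f) ε) 1 fun j hj =>
      one_le_boxCount hε (Set.Nonempty.image _ ⟨_, leftPt_mem_subInterval hac⟩)
        (finite_boxIndices_subInterval hN hac hf hε (Finset.mem_range.1 hj))
  rw [Finset.card_range, smul_eq_mul, mul_one] at hcolumns
  exact_mod_cast hcolumns.trans (sum_boxCount_subInterval_le hN hac hf hε hk)

lemma totalOsc_div_le_boxCount_graphOn_Icc (hN : 0 < N) (hac : a ≤ c)
    (hf : ContinuousOn f (Set.Icc a c)) (hε : 0 < ε) (hk : ε ≤ (c - a) / (N : ℝ) ^ k) :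
    totalOsc N k f a c / ε ≤ 3 * boxCount ((Set.Icc a c).graphOn f) ε := by
  have hb : Bornology.IsBounded (f '' Set.Icc a c) :=
    (isCompact_Icc.image_of_continuousOn hf).isBounded
  rw [totalOsc, Finset.sum_div]
  have hsum : ∑ j ∈ Finset.range (N ^ k), (boxCount ((subInterval N a c k j).graphOn f) ε : ℝ) ≤
      3 * boxCount ((Set.Icc a c).graphOn f) ε := by
    exact_mod_cast sum_boxCount_subInterval_le hN hac hb hε hk
  refine (Finset.sum_le_sum fun j hj => ?_).trans hsum
  have hj' := Finset.mem_range.1 hj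
  exact oscillation_div_le_boxCount hε isPreconnected_Icc
    (hf.mono (subInterval_subset_Icc hN hac hj')) (finite_boxIndices_subInterval hN hac hb hε hj')

end GraphOverInterval

/-! ### From box counts to the box dimension -/

section BoxDimension

variable {E : Set (ℝ × ℝ)} {b d s κ : ℝ}

lemma tendsto_log_one_div : Tendsto (fun ε : ℝ => Real.log (1 / ε)) (𝓝[>] 0) atTop := by
  simp only [one_div]
  exact Real.tendsto_log_atTop.comp tendsto_inv_nhdsGT_zero

lemma eventually_lt_log_boxCount_div (hκ : 0 < κ) (hbs : b < s)
    (h : ∀ᶠ ε in 𝓝[>] (0 : ℝ), κ * (1 / ε) ^ s ≤ boxCount E ε) :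
    ∀ᶠ ε in 𝓝[>] (0 : ℝ), b < Real.log (boxCount E ε) / Real.log (1 / ε) := by
  filter_upwards [h, self_mem_nhdsWithin, tendsto_log_one_div.eventually_gt_atTop 0,
    tendsto_log_one_div.eventually_gt_atTop (-Real.log κ / (s - b))]
    with ε hle (hε : 0 < ε) hlog hlarge
  have hx : 0 < 1 / ε := by positivity
  have hloglog := Real.log_le_log (by positivity) hle
  rw [Real.log_mul hκ.ne' (Real.rpow_pos_of_pos hx _).ne', Real.log_rpow hx] at hloglog
  rw [div_lt_iff₀ (sub_pos.2 hbs)] at hlarge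
  rw [lt_div_iff₀ hlog]
  linarith

lemma eventually_log_boxCount_div_lt (hκ : 0 < κ) (hsb : s < b)
    (hpos : ∀ᶠ ε in 𝓝[>] (0 : ℝ), 0 < boxCount E ε)
    (h : ∀ᶠ ε in 𝓝[>] (0 : ℝ), boxCount E ε ≤ κ * (1 / ε) ^ s) :
    ∀ᶠ ε in 𝓝[>] (0 : ℝ), Real.log (boxCount E ε) / Real.log (1 / ε) < b := by
  filter_upwards [h, hpos, self_mem_nhdsWithin, tendsto_log_one_div.eventually_gt_atTop 0,
    tendsto_log_one_div.eventually_gt_atTop (Real.log κ / (b - s))]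
    with ε hle hcount (hε : 0 < ε) hlog hlarge
  have hx : 0 < 1 / ε := by positivity
  have hloglog := Real.log_le_log (Nat.cast_pos.2 hcount) hle
  rw [Real.log_mul hκ.ne' (Real.rpow_pos_of_pos hx _).ne', Real.log_rpow hx] at hloglog
  rw [div_lt_iff₀ (sub_pos.2 hsb)] at hlarge
  rw [div_lt_iff₀ hlog]
  linarith

lemma hasBoxDim_of_rpow_bounds
    (hlow : ∀ b < d, ∃ s > b, ∃ κ > 0, ∀ᶠ ε in 𝓝[>] (0 : ℝ), κ * (1 / ε) ^ s ≤ boxCount E ε)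
    (hupp : ∀ b > d, ∃ s < b, ∃ κ > 0, ∀ᶠ ε in 𝓝[>] (0 : ℝ),
      (boxCount E ε : ℝ) ≤ κ * (1 / ε) ^ s) :
    HasBoxDim E d := by
  have hpos : ∀ᶠ ε in 𝓝[>] (0 : ℝ), 0 < boxCount E ε := by
    obtain ⟨s, _, κ, hκ, h⟩ := hlow (d - 1) (sub_one_lt d)
    filter_upwards [h, self_mem_nhdsWithin] with ε hle (hε : 0 < ε)
    exact Nat.cast_pos.1 (lt_of_lt_of_le (by positivity) hle)
  have hlim : Tendsto (fun ε : ℝ => Real.log (boxCount E ε) / Real.log (1 / ε)) (𝓝[>] 0)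
      (𝓝 d) := by
    refine tendsto_order.2 ⟨fun b hb => ?_, fun b hb => ?_⟩
    · obtain ⟨s, hs, κ, hκ, h⟩ := hlow b hb
      exact eventually_lt_log_boxCount_div hκ hs h
    · obtain ⟨s, hs, κ, hκ, h⟩ := hupp b hb
      exact eventually_log_boxCount_div_lt hκ hs hpos h
  have hlimE : Tendsto (fun ε : ℝ =>
      ((Real.log (boxCount E ε) / Real.log (1 / ε) : ℝ) : EReal)) (𝓝[>] 0) (𝓝 (d : EReal)) :=
    (continuous_coe_real_ereal.tendsto d).comp hlim
  exact ⟨hlimE.liminf_eq, hlimE.limsup_eq⟩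

end BoxDimension

section GeometricScales

variable {N p : ℕ} {w s d ε : ℝ}

/-- The scales between `w / N ^ (p + 1)` and `w / N ^ p`. -/
def scaleRange (N : ℕ) (w : ℝ) (p : ℕ) : Set ℝ :=
  Set.Icc (w / (N : ℝ) ^ (p + 1)) (w / (N : ℝ) ^ p)

lemma pos_of_mem_scaleRange (hN : 0 < N) (hw : 0 < w) (hε : ε ∈ scaleRange N w p) : 0 < ε :=
  lt_of_lt_of_le (by positivity) hε.1

lemma eventually_exists_mem_scaleRange (hN : 1 < N) (hw : 0 < w) {Q : ℕ → ℝ → Prop}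
    (hQ : ∀ᶠ p in atTop, ∀ ε ∈ scaleRange N w p, Q p ε) :
    ∀ᶠ ε in 𝓝[>] (0 : ℝ), ∃ p, ε ∈ scaleRange N w p ∧ Q p ε := by
  obtain ⟨P, hP⟩ := eventually_atTop.1 hQ
  have hN1 : (1 : ℝ) < N := by exact_mod_cast hN
  filter_upwards [Ioo_mem_nhdsGT (show 0 < w / (N : ℝ) ^ P by positivity)] with ε ⟨hε, hεP⟩
  rw [lt_div_comm₀ hε (by positivity)] at hεP
  obtain ⟨p, hp, hp'⟩ := exists_nat_pow_near ((one_le_pow₀ hN1.le).trans hεP.le) hN1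
  have hscale : ε ∈ scaleRange N w p :=
    ⟨(div_le_comm₀ (by positivity) hε).2 hp'.le, (le_div_comm₀ hε (by positivity)).2 hp⟩
  exact ⟨p, hscale, hP p (Nat.lt_succ_iff.1 ((pow_lt_pow_iff_right₀ hN1).1 (hεP.trans hp'))) ε
    hscale⟩

lemma rpow_pow_le_of_mem_scaleRange (hN : 0 < N) (hw : 0 < w) (hs : 0 ≤ s)
    (hε : ε ∈ scaleRange N w p) : ((N : ℝ) ^ s) ^ p ≤ w ^ s * (1 / ε) ^ s := by
  have hε0 := pos_of_mem_scaleRange hN hw hε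
  rw [Real.rpow_pow_comm N.cast_nonneg, ← Real.mul_rpow hw.le (by positivity), mul_one_div]
  exact Real.rpow_le_rpow (by positivity) ((le_div_comm₀ hε0 (by positivity)).1 hε.2) hs

lemma le_rpow_pow_of_mem_scaleRange (hN : 0 < N) (hw : 0 < w) (hs : 0 ≤ s)
    (hε : ε ∈ scaleRange N w p) : w ^ s * (1 / ε) ^ s ≤ ((N : ℝ) ^ s) ^ (p + 1) := by
  have hε0 := pos_of_mem_scaleRange hN hw hε
  rw [Real.rpow_pow_comm N.cast_nonneg, ← Real.mul_rpow hw.le (by positivity), mul_one_div]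
  exact Real.rpow_le_rpow (by positivity) ((div_le_comm₀ (by positivity) hε0).1 hε.1) hs

lemma hasBoxDim_of_scaleRange_bounds {E : Set (ℝ × ℝ)} (hN : 1 < N) (hw : 0 < w) (hd : 0 < d)
    (hlow : ∀ s, 0 < s → s < d → ∃ κ > 0, ∀ᶠ p in atTop, ∀ ε ∈ scaleRange N w p,
      κ * ((N : ℝ) ^ s) ^ p ≤ boxCount E ε)
    (hupp : ∀ s > d, ∃ κ > 0, ∀ᶠ p in atTop, ∀ ε ∈ scaleRange N w p,
      boxCount E ε ≤ κ * ((N : ℝ) ^ s) ^ p) :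
    HasBoxDim E d := by
  have hN0 : 0 < N := one_pos.trans hN
  refine hasBoxDim_of_rpow_bounds (fun b hb => ?_) fun b hb => ?_
  · obtain ⟨s, hs, hsd⟩ := exists_between (max_lt hd hb)
    have hs0 : 0 < s := (le_max_left _ _).trans_lt hs
    obtain ⟨κ, hκ, h⟩ := hlow s hs0 hsd
    refine ⟨s, (le_max_right _ _).trans_lt hs, κ * w ^ s / (N : ℝ) ^ s, by positivity, ?_⟩
    filter_upwards [eventually_exists_mem_scaleRange hN hw h] with ε ⟨p, hε, hle⟩
    calc κ * w ^ s / (N : ℝ) ^ s * (1 / ε) ^ s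
        = κ / (N : ℝ) ^ s * (w ^ s * (1 / ε) ^ s) := by ring
      _ ≤ κ / (N : ℝ) ^ s * ((N : ℝ) ^ s) ^ (p + 1) := by
          gcongr
          exact le_rpow_pow_of_mem_scaleRange hN0 hw hs0.le hε
      _ = κ * ((N : ℝ) ^ s) ^ p := by
          have : (N : ℝ) ^ s ≠ 0 := by positivity
          rw [pow_succ']
          field_simp
      _ ≤ boxCount E ε := hle
  · obtain ⟨s, hds, hsb⟩ := exists_between hb
    obtain ⟨κ, hκ, h⟩ := hupp s hds
    refine ⟨s, hsb, κ * w ^ s, by positivity, ?_⟩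
    filter_upwards [eventually_exists_mem_scaleRange hN hw h] with ε ⟨p, hε, hle⟩
    rw [mul_assoc]
    refine hle.trans ?_
    gcongr
    exact rpow_pow_le_of_mem_scaleRange hN0 hw (hd.trans hds).le hε

end GeometricScales

section GraphDimension

variable {N : ℕ} {a c s e κ D : ℝ} {f : ℝ → ℝ}

lemma rpow_pow_eq_mul (hN : 0 < N) (s : ℝ) (p : ℕ) :
    ((N : ℝ) ^ s) ^ p = ((N : ℝ) ^ (s - 1)) ^ p * (N : ℝ) ^ p := by
  rw [← mul_pow, ← Real.rpow_add_one (by positivity), sub_add_cancel]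

lemma exists_rpow_pow_le_boxCount_graphOn_Icc_of_le_one (hN : 0 < N) (hac : a < c)
    (hf : Bornology.IsBounded (f '' Set.Icc a c)) (hs : s ≤ 1) :
    ∃ κ > 0, ∀ᶠ p in atTop, ∀ ε ∈ scaleRange N (c - a) p,
      κ * ((N : ℝ) ^ s) ^ p ≤ boxCount ((Set.Icc a c).graphOn f) ε := by
  refine ⟨1 / 3, by norm_num, .of_forall fun p ε hε => ?_⟩
  have hpow : ((N : ℝ) ^ s) ^ p ≤ (N : ℝ) ^ p := by
    gcongr
    simpa only [Real.rpow_one] using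
      Real.rpow_le_rpow_of_exponent_le (show (1 : ℝ) ≤ N by exact_mod_cast hN) hs
  linarith [pow_le_boxCount_graphOn_Icc hN hac.le hf
    (pos_of_mem_scaleRange hN (sub_pos.2 hac) hε) hε.2]

lemma exists_rpow_pow_le_boxCount_graphOn_Icc (hN : 0 < N) (hac : a < c)
    (hf : ContinuousOn f (Set.Icc a c)) (hκ : 0 < κ)
    (hosc : ∀ᶠ p in atTop, κ * ((N : ℝ) ^ (s - 1)) ^ p ≤ totalOsc N p f a c) :
    ∃ κ > 0, ∀ᶠ p in atTop, ∀ ε ∈ scaleRange N (c - a) p,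
      κ * ((N : ℝ) ^ s) ^ p ≤ boxCount ((Set.Icc a c).graphOn f) ε := by
  have hw : 0 < c - a := sub_pos.2 hac
  refine ⟨κ / (3 * (c - a)), by positivity, ?_⟩
  filter_upwards [hosc] with p hp ε hε
  have hε0 := pos_of_mem_scaleRange hN hw hε
  have hdiv : κ * ((N : ℝ) ^ (s - 1)) ^ p / ((c - a) / (N : ℝ) ^ p) ≤ totalOsc N p f a c / ε :=
    div_le_div₀ totalOsc_nonneg hp hε0 hε.2
  calc κ / (3 * (c - a)) * ((N : ℝ) ^ s) ^ p
      = κ * ((N : ℝ) ^ (s - 1)) ^ p / ((c - a) / (N : ℝ) ^ p) / 3 := by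
        rw [rpow_pow_eq_mul hN]
        field_simp
    _ ≤ boxCount ((Set.Icc a c).graphOn f) ε := by
        linarith [totalOsc_div_le_boxCount_graphOn_Icc hN hac.le hf hε0 hε.2]

lemma exists_boxCount_graphOn_Icc_le_rpow_pow (hN : 0 < N) (hac : a < c)
    (hf : Bornology.IsBounded (f '' Set.Icc a c)) (hs : 1 ≤ s)
    (hosc : ∀ p, totalOsc N p f a c ≤ D * ((N : ℝ) ^ (s - 1)) ^ p) :
    ∃ κ > 0, ∀ᶠ p in atTop, ∀ ε ∈ scaleRange N (c - a) p,
      boxCount ((Set.Icc a c).graphOn f) ε ≤ κ * ((N : ℝ) ^ s) ^ p := by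
  have hw : 0 < c - a := sub_pos.2 hac
  have hD : 0 ≤ D := by simpa using totalOsc_nonneg.trans (hosc 0)
  refine ⟨6 * (D / (c - a) + 1) * (N : ℝ) ^ s, by positivity, .of_forall fun p ε hε => ?_⟩
  have hdiv : totalOsc N (p + 1) f a c / ε ≤
      D * ((N : ℝ) ^ (s - 1)) ^ (p + 1) / ((c - a) / (N : ℝ) ^ (p + 1)) :=
    div_le_div₀ (by positivity) (hosc _) (by positivity) hε.1
  have hpow : (N : ℝ) ^ (p + 1) ≤ ((N : ℝ) ^ (s - 1)) ^ (p + 1) * (N : ℝ) ^ (p + 1) :=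
    le_mul_of_one_le_left (by positivity)
      (one_le_pow₀ (Real.one_le_rpow (by exact_mod_cast hN) (sub_nonneg.2 hs)))
  calc (boxCount ((Set.Icc a c).graphOn f) ε : ℝ)
      ≤ 6 * (totalOsc N (p + 1) f a c / ε + (N : ℝ) ^ (p + 1)) :=
        boxCount_graphOn_Icc_le hN hac.le hf (pos_of_mem_scaleRange hN hw hε) hε.1
    _ ≤ 6 * (D * ((N : ℝ) ^ (s - 1)) ^ (p + 1) / ((c - a) / (N : ℝ) ^ (p + 1)) +
          ((N : ℝ) ^ (s - 1)) ^ (p + 1) * (N : ℝ) ^ (p + 1)) := by gcongr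
    _ = 6 * (D / (c - a) + 1) * (((N : ℝ) ^ (s - 1)) ^ (p + 1) * (N : ℝ) ^ (p + 1)) := by
        field_simp
    _ = 6 * (D / (c - a) + 1) * (N : ℝ) ^ s * ((N : ℝ) ^ s) ^ p := by
        rw [← rpow_pow_eq_mul hN, pow_succ']
        ring

lemma hasBoxDim_graphOn_Icc (hN : 1 < N) (hac : a < c) (hf : ContinuousOn f (Set.Icc a c))
    (he : 0 ≤ e)
    (hlow : ∀ s, 0 < s → s < e → ∃ κ > 0, ∀ᶠ p in atTop,
      κ * ((N : ℝ) ^ s) ^ p ≤ totalOsc N p f a c)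
    (hupp : ∀ s > e, ∃ D, ∀ p, totalOsc N p f a c ≤ D * ((N : ℝ) ^ s) ^ p) :
    HasBoxDim ((Set.Icc a c).graphOn f) (1 + e) := by
  have hN0 : 0 < N := one_pos.trans hN
  have hb : Bornology.IsBounded (f '' Set.Icc a c) :=
    (isCompact_Icc.image_of_continuousOn hf).isBounded
  refine hasBoxDim_of_scaleRange_bounds hN (sub_pos.2 hac) (by linarith) (fun s _ hs => ?_)
    fun s hs => ?_
  · rcases le_or_gt s 1 with hs1 | hs1
    · exact exists_rpow_pow_le_boxCount_graphOn_Icc_of_le_one hN0 hac hb hs1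
    · obtain ⟨κ, hκ, hosc⟩ := hlow (s - 1) (sub_pos.2 hs1) (sub_lt_iff_lt_add'.2 hs)
      exact exists_rpow_pow_le_boxCount_graphOn_Icc hN0 hac hf hκ hosc
  · obtain ⟨D, hosc⟩ := hupp (s - 1) (lt_sub_iff_add_lt'.2 hs)
    exact exists_boxCount_graphOn_Icc_le_rpow_pow hN0 hac hb (by linarith) hosc

end GraphDimension

section ApproxSelfAffineGraph

variable {N : ℕ} {a c ρ : ℝ} {S f : ℝ → ℝ} {Λ C : NNReal}

lemma hasBoxDim_graphOn_Icc_of_one_lt (h : IsLeadingEigenvalue N a c S Λ ρ)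
    (hfS : ApproxSelfAffine N a c S f C) (hN : 1 < N) (hac : a < c)
    (hS : ∀ t ∈ Set.Icc a c, 0 ≤ S t) (hf : ContinuousOn f (Set.Icc a c)) (hρ : 1 < ρ)
    (htop : Tendsto (fun p => totalOsc N p f a c) atTop atTop) :
    HasBoxDim ((Set.Icc a c).graphOn f) (1 + Real.log ρ / Real.log N) := by
  have hN0 : 0 < N := one_pos.trans hN
  have hN1 : (1 : ℝ) < N := by exact_mod_cast hN
  have hb : Bornology.IsBounded (f '' Set.Icc a c) :=
    (isCompact_Icc.image_of_continuousOn hf).isBounded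
  have hlog : 0 < Real.logb N ρ := Real.logb_pos hN1 hρ
  rw [Real.log_div_log]
  refine hasBoxDim_graphOn_Icc hN hac hf hlog.le (fun s hs hsρ => ?_) fun s hρs => ?_
  · exact (h.isSubeigenvalue _ (by positivity)
      ((Real.lt_logb_iff_rpow_lt hN1 h.pos).1 hsρ)).exists_le_totalOsc hfS hN0 hac.le hS hb
      (Real.one_lt_rpow hN1 hs) htop
  · exact (h.isSupereigenvalue _
      ((Real.logb_lt_iff_lt_rpow hN1 h.pos).1 hρs)).exists_totalOsc_le hfS hN0 hac.le hS hb
      (Real.one_lt_rpow hN1 (hlog.trans hρs))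

lemma exists_totalOsc_le_of_not_tendsto (hN : 0 < N) (hac : a ≤ c)
    (hf : ¬ Tendsto (fun p => totalOsc N p f a c) atTop atTop) :
    ∃ D, ∀ p, totalOsc N p f a c ≤ D := by
  obtain ⟨l, hl⟩ := (tendsto_atTop_of_monotone (monotone_totalOsc hN hac f)).resolve_left hf
  exact ⟨l, (monotone_totalOsc hN hac f).ge_of_tendsto hl⟩

lemma hasBoxDim_graphOn_Icc_one (h : IsLeadingEigenvalue N a c S Λ ρ)
    (hfS : ApproxSelfAffine N a c S f C) (hN : 1 < N) (hac : a < c)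
    (hS : ∀ t ∈ Set.Icc a c, 0 ≤ S t) (hf : ContinuousOn f (Set.Icc a c))
    (hnot : ¬ (Tendsto (fun p => totalOsc N p f a c) atTop atTop ∧ 1 < ρ)) :
    HasBoxDim ((Set.Icc a c).graphOn f) 1 := by
  have hN0 : 0 < N := one_pos.trans hN
  have hb : Bornology.IsBounded (f '' Set.Icc a c) :=
    (isCompact_Icc.image_of_continuousOn hf).isBounded
  rw [← add_zero (1 : ℝ)]
  refine hasBoxDim_graphOn_Icc hN hac hf le_rfl (fun s hs hs' => absurd hs' hs.not_gt)
    fun s hs => ?_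
  have hr : 1 < (N : ℝ) ^ s := Real.one_lt_rpow (by exact_mod_cast hN) hs
  rcases not_and_or.1 hnot with hosc | hρ
  · obtain ⟨D, hD⟩ := exists_totalOsc_le_of_not_tendsto hN0 hac.le hosc
    exact ⟨D, fun p => (hD p).trans
      (le_mul_of_one_le_right (totalOsc_nonneg.trans (hD p)) (one_le_pow₀ hr.le))⟩
  · exact (h.isSupereigenvalue _ ((not_lt.1 hρ).trans_lt hr)).exists_totalOsc_le hfS hN0 hac.le
      hS hb hr

lemma approxSelfAffine_of_functional_eq {b h : ℝ → ℝ} {K B H G : NNReal}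
    (hSK : LipschitzOnWith K S (Set.Icc a c)) (hS : ∀ t ∈ Set.Icc a c, |S t| ≤ 1)
    (hb : LipschitzOnWith B b (Set.Icc a c))
    (hh : ∀ i < N, LipschitzOnWith H (fun t => h (branch N a c i t)) (Set.Icc a c))
    (hG : ∀ t ∈ Set.Icc a c, |f t - b t| ≤ G)
    (heq : ∀ i < N, ∀ t ∈ Set.Icc a c, f (branch N a c i t) =
      S (branch N a c i t) * (f t - b t) + h (branch N a c i t)) :
    ApproxSelfAffine N a c S f (K * G + B + H) := by
  intro i hi u hu s hs t ht
  have hN : (1 : ℝ) ≤ N := by exact_mod_cast Nat.one_le_of_lt hi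
  have hscaling : ∀ v ∈ Set.Icc a c,
      |(S (branch N a c i v) - S (branch N a c i u)) * (f v - b v)| ≤ K * dist v u * G := by
    intro v hv
    have hdist : dist (branch N a c i v) (branch N a c i u) ≤ dist v u := by
      rw [dist_branch]
      exact div_le_self dist_nonneg hN
    have hSvu := hSK.dist_le_mul _ (branch_mem_Icc hi hv) _ (branch_mem_Icc hi hu)
    rw [abs_mul]
    gcongr
    · exact hSvu.trans (by gcongr)
    · exact hG v hv
  have hbase : |S (branch N a c i u) * (b s - b t)| ≤ B * (dist s u + dist t u) := by
    rw [abs_mul]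
    refine (mul_le_of_le_one_left (abs_nonneg _) (hS _ (branch_mem_Icc hi hu))).trans
      ((hb.dist_le_mul s hs t ht).trans ?_)
    gcongr
    exact dist_triangle_right s t u
  have hinterp : |h (branch N a c i s) - h (branch N a c i t)| ≤ H * (dist s u + dist t u) :=
    ((hh i hi).dist_le_mul s hs t ht).trans (by gcongr; exact dist_triangle_right s t u)
  have hs' := abs_le.1 (hscaling s hs)
  have ht' := abs_le.1 (hscaling t ht)
  rw [abs_le] at hbase hinterp ⊢
  push_cast
  rw [heq i hi s hs, heq i hi t ht]
  constructor <;> linarith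

end ApproxSelfAffineGraph

/-! ### Generalized affine fractal interpolation functions -/

lemma IsLinearOn.exists_lipschitzOnWith {g : ℝ → ℝ} {E : Set ℝ} (hg : IsLinearOn g E) :
    ∃ K, LipschitzOnWith K g E := by
  obtain ⟨m, d, hg⟩ := hg
  refine ⟨‖m‖₊, LipschitzOnWith.of_dist_le_mul fun s hs t ht => le_of_eq ?_⟩
  rw [hg s hs, hg t ht, dist_add_right, Real.dist_eq, ← mul_sub, abs_mul, coe_nnnorm,
    Real.norm_eq_abs, Real.dist_eq]

section Nodes

variable {N : ℕ} {x : Fin (N + 1) → ℝ}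

lemma node_eq
    (hunif : ∀ i : Fin N, x i.succ - x i.castSucc = (x (Fin.last N) - x 0) / (N : ℝ))
    (i : Fin (N + 1)) : x i = x 0 + (i : ℝ) / N * (x (Fin.last N) - x 0) := by
  induction i using Fin.induction with
  | zero => simp
  | succ i ih =>
    have hstep := hunif i
    rw [ih] at hstep
    simp only [Fin.val_succ, Fin.val_castSucc] at hstep ⊢
    push_cast
    linear_combination hstep

lemma branch_eq_node_add
    (hunif : ∀ i : Fin N, x i.succ - x i.castSucc = (x (Fin.last N) - x 0) / (N : ℝ))
    (i : Fin N) (t : ℝ) :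
    branch N (x 0) (x (Fin.last N)) i t = x i.castSucc + (t - x 0) / N := by
  rw [branch, node_eq hunif i.castSucc, Fin.val_castSucc]

lemma branch_mem_Icc_node
    (hunif : ∀ i : Fin N, x i.succ - x i.castSucc = (x (Fin.last N) - x 0) / (N : ℝ))
    (i : Fin N) {t : ℝ} (ht : t ∈ nodeInterval x) :
    branch N (x 0) (x (Fin.last N)) i t ∈ Set.Icc (x i.castSucc) (x i.succ) := by
  rw [branch_eq_node_add hunif, eq_add_of_sub_eq' (hunif i)]
  refine ⟨le_add_of_nonneg_right (div_nonneg (sub_nonneg.2 ht.1) N.cast_nonneg), ?_⟩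
  gcongr
  exact ht.2

end Nodes

namespace IsGeneralizedAffineFIF

variable {N : ℕ} {x y : Fin (N + 1) → ℝ} {b h : ℝ → ℝ} {L : Fin N → ℝ → ℝ} {S f : ℝ → ℝ}

lemma L_eq_branch (hf : IsGeneralizedAffineFIF x y b h L S f) (hx : x 0 < x (Fin.last N))
    (hunif : ∀ i : Fin N, x i.succ - x i.castSucc = (x (Fin.last N) - x 0) / (N : ℝ))
    (i : Fin N) {t : ℝ} (ht : t ∈ nodeInterval x) :
    L i t = branch N (x 0) (x (Fin.last N)) i t := by
  obtain ⟨m, d, hL⟩ := hf.L_linear i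
  have hleft := hf.L_left i
  have hright := hf.L_right i
  rw [hL _ (Set.left_mem_Icc.2 hx.le)] at hleft
  rw [hL _ (Set.right_mem_Icc.2 hx.le)] at hright
  have hslope : m = 1 / N := mul_right_cancel₀ (sub_pos.2 hx).ne' <| by
    linear_combination hright - hleft + hunif i
  rw [hL t ht, branch_eq_node_add hunif, ← hleft, hslope]
  ring

lemma functional_eq (hf : IsGeneralizedAffineFIF x y b h L S f) (hx : x 0 < x (Fin.last N))
    (hunif : ∀ i : Fin N, x i.succ - x i.castSucc = (x (Fin.last N) - x 0) / (N : ℝ))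
    (i : Fin N) {t : ℝ} (ht : t ∈ nodeInterval x) :
    f (branch N (x 0) (x (Fin.last N)) i t) =
      S (branch N (x 0) (x (Fin.last N)) i t) * (f t - b t) +
        h (branch N (x 0) (x (Fin.last N)) i t) := by
  have hmem : ifsMap b h S (L i) (t, f t) ∈ (nodeInterval x).graphOn f := by
    rw [hf.graph_invariant]
    exact Set.mem_iUnion.2 ⟨i, (t, f t), ⟨t, ht, rfl⟩, rfl⟩
  obtain ⟨s, _, hs⟩ := hmem
  simp only [ifsMap, Prod.mk.injEq, hf.L_eq_branch hx hunif i ht] at hs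
  rw [← hs.2, ← hs.1]

lemma exists_lipschitzOnWith_h_branch (hf : IsGeneralizedAffineFIF x y b h L S f)
    (hunif : ∀ i : Fin N, x i.succ - x i.castSucc = (x (Fin.last N) - x 0) / (N : ℝ)) :
    ∃ H, ∀ i < N, LipschitzOnWith H (fun t => h (branch N (x 0) (x (Fin.last N)) i t))
      (nodeInterval x) := by
  choose H hH using fun i => (hf.h_linear i).exists_lipschitzOnWith
  refine ⟨∑ i, H i * (N : NNReal)⁻¹, fun i hi => ?_⟩
  exact ((hH ⟨i, hi⟩).comp (lipschitzWith_branch i).lipschitzOnWith fun t ht =>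
    branch_mem_Icc_node hunif ⟨i, hi⟩ ht).weaken
      (Finset.single_le_sum (f := fun i => H i * (N : NNReal)⁻¹) (fun _ _ => zero_le)
        (Finset.mem_univ _))

lemma exists_approxSelfAffine (hf : IsGeneralizedAffineFIF x y b h L S f)
    (hx : x 0 < x (Fin.last N))
    (hunif : ∀ i : Fin N, x i.succ - x i.castSucc = (x (Fin.last N) - x 0) / (N : ℝ))
    {K : NNReal} (hK : LipschitzOnWith K S (nodeInterval x)) :
    ∃ C, ApproxSelfAffine N (x 0) (x (Fin.last N)) S f C := by
  obtain ⟨B, hB⟩ := hf.b_linear.exists_lipschitzOnWith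
  obtain ⟨H, hH⟩ := hf.exists_lipschitzOnWith_h_branch hunif
  obtain ⟨G, hG⟩ := isCompact_Icc.exists_bound_of_continuousOn
    (hf.f_continuous.sub hB.continuousOn)
  have hG0 : 0 ≤ G := (norm_nonneg _).trans (hG (x 0) (Set.left_mem_Icc.2 hx.le))
  lift G to NNReal using hG0
  exact ⟨K * G + B + H, approxSelfAffine_of_functional_eq hK
    (fun t ht => (hf.S_abs_lt_one t ht).le) hB hH hG
    fun i hi t ht => hf.functional_eq hx hunif ⟨i, hi⟩ ht⟩

end IsGeneralizedAffineFIF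

end FIF

end

theorem theorem4p10 (N : ℕ) (hN : 2 ≤ N) (x y : Fin (N + 1) → ℝ) (hx : StrictMono x)
    (b h : ℝ → ℝ) (L : Fin N → ℝ → ℝ) (S f : ℝ → ℝ)
    (hf : FIF.IsGeneralizedAffineFIF x y b h L S f)
    (hunif : ∀ i : Fin N, x i.succ - x i.castSucc = (x (Fin.last N) - x 0) / (N : ℝ))
    (hLip : ∃ K : NNReal, LipschitzOnWith K S (FIF.nodeInterval x))
    (hpos : ∀ t ∈ FIF.nodeInterval x, 0 < S t) :
    ∃ ρ : ℝ,
      Filter.Tendsto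
        (fun k : ℕ => FIF.matrixSpectralRadius (FIF.upperMatrix N (x 0) (x (Fin.last N)) S k))
        Filter.atTop (nhds ρ) ∧
      Filter.Tendsto
        (fun k : ℕ => FIF.matrixSpectralRadius (FIF.lowerMatrix N (x 0) (x (Fin.last N)) S k))
        Filter.atTop (nhds ρ) ∧
      ((Filter.Tendsto (fun p : ℕ => FIF.totalOsc N p f (x 0) (x (Fin.last N)))
            Filter.atTop Filter.atTop ∧ 1 < ρ) →
        FIF.HasBoxDim ((FIF.nodeInterval x).graphOn f) (1 + Real.log ρ / Real.log N)) ∧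
      (¬ (Filter.Tendsto (fun p : ℕ => FIF.totalOsc N p f (x 0) (x (Fin.last N)))
            Filter.atTop Filter.atTop ∧ 1 < ρ) →
        FIF.HasBoxDim ((FIF.nodeInterval x).graphOn f) 1) := by
  have hN0 : 0 < N := by omega
  have hac : x 0 < x (Fin.last N) := hx (Fin.lt_def.2 hN0)
  have hS0 : ∀ t ∈ FIF.nodeInterval x, 0 ≤ S t := fun t ht => (hpos t ht).le
  obtain ⟨K, hK⟩ := hLip
  obtain ⟨C, hfS⟩ := hf.exists_approxSelfAffine hac hunif hK
  obtain ⟨Λ, hΛ⟩ := FIF.exists_logLipOn_of_lipschitzOnWith isCompact_Icc hK hpos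
  obtain ⟨ρ, hρ⟩ := FIF.exists_isLeadingEigenvalue hN hac.le hΛ
  refine ⟨ρ, ?_, ?_, fun ⟨htop, hρ1⟩ => ?_, fun hnot => ?_⟩
  · exact hρ.tendsto_matrixSpectralRadius hN hac.le hΛ fun k i hi j hj =>
      FIF.sUpper_mem_image hN0 hac.le hf.S_continuous hS0 hi hj
  · exact hρ.tendsto_matrixSpectralRadius hN hac.le hΛ fun k i hi j hj =>
      FIF.sLower_mem_image hN0 hac.le hf.S_continuous hS0 hi hj
  · exact FIF.hasBoxDim_graphOn_Icc_of_one_lt hρ hfS hN hac hS0 hf.f_continuous hρ1 htop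
  · exact FIF.hasBoxDim_graphOn_Icc_one hρ hfS hN hac hS0 hf.f_continuous hnot
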